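/- Fix a dimension $n$ and let $\mathcal{P}^n$ be the collection of all cubes in $\mathbb{R}^n$ (half-open, with arbitrary centre) with sides parallel to the coordinate axes and side length $2^k$ for some $k\in\mathbb{Z}$. For $Q\in\mathcal{P}^n$ and $\Gamma\ge 1$ let $\Gamma Q$ be the cube concentric with $Q$ whose side length is $\Gamma$ times that of $Q$; write $|Q|$ for the Lebesgue measure of $Q$ and $|E|_\mu=\mu(E)$. For a locally finite signed measure $\mu$ with total variation $|\mu|$, let $$\mathcal{M}\mu(x)=\sup_{Q\in\mathcal{P}^n:\ x\in Q}\frac{1}{|Q|}\int_Q d|\mu| .$$ For locally finite positive Borel measures $\sigma,\omega$ on $\mathbb{R}^n$ and $\Gamma>1$ define the following elements of $[0,\infty]$ (a best constant is $\infty$ if no finite one exists): - $\mathfrak{N}_{\mathcal{M}}(\sigma,\omega)$ is the best constant in $\int_{\mathbb{R}^n}\mathcal{M}(f\sigma)^2\,d\omega\le \mathfrak{N}_{\mathcal{M}}(\sigma,\omega)^2\int_{\mathbb{R}^n}|f|^2\,d\sigma$ for all $f\in L^2(\sigma)$; - $\mathfrak{T}_{\mathcal{M}}(\Gamma)(\sigma,\omega)$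 is the best constant in $\int_Q \mathcal{M}(\mathbf{1}_Q\sigma)^2\,d\omega\le \mathfrak{T}_{\mathcal{M}}(\Gamma)(\sigma,\omega)^2\,|\Gamma Q|_\sigma$ for all $Q\in\mathcal{P}^n$; - $A_2(\sigma,\omega)=\sup_{Q\in\mathcal{P}^n}\frac{|Q|_\sigma}{|Q|}\cdot\frac{|Q|_\omega}{|Q|}$. **Theorem.** For every $n$ and every $\Gamma>1$ there are constants $0<c\le C<\infty$, depending only on $n$ and $\Gamma$, such that for all pairs $(\sigma,\omega)$ of locally finite positive Borel measures on $\mathbb{R}^n$ $$c\left(\mathfrak{T}_{\mathcal{M}}(\Gamma)(\sigma,\omega)+\sqrt{A_2(\sigma,\omega)}\right)\le \mathfrak{N}_{\mathcal{M}}(\sigma,\omega)\le C\left(\mathfrak{T}_{\mathcal{M}}(\Gamma)(\sigma,\omega)+\sqrt{A_2(\sigma,\omega)}\right).$$ In particular $\mathcal{M}(\cdot\,\sigma)$ is bounded from $L^2(\sigma)$ to $L^2(\omega)$ if and only if the $\Gamma$-testing condition and the $A_2$ condition hold. -/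

import Mathlib

open MeasureTheory
open scoped ENNReal NNReal

noncomputable section

namespace RestrictedTesting

/-- The cube in `ℝⁿ` with sides parallel to the coordinate axes, centre `c` and side length `ℓ`,
taken half-open, as dyadic cubes are.
(Here `ℝⁿ` is `Fin n → ℝ`; only its topology, its Borel sets and Lebesgue measure are used.) -/
def box {n : ℕ} (c : Fin n → ℝ) (ℓ : ℝ) : Set (Fin n → ℝ) :=
  Set.univ.pi fun i => Set.Ico (c i - ℓ / 2) (c i + ℓ / 2)

/-- The collection `𝒫ⁿ` of all cubes in `ℝⁿ` with sides parallel to the coordinate axes, arbitrary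
centre, and side length `2 ^ scale` an integral power of two. -/
structure Cube (n : ℕ) where
  /-- the centre of the cube -/
  center : Fin n → ℝ
  /-- the base-two logarithm of the side length -/
  scale : ℤ

namespace Cube

variable {n : ℕ}

/-- The side length of a cube. -/
def side (Q : Cube n) : ℝ := 2 ^ Q.scale

/-- The set of points of a cube. -/
def toSet (Q : Cube n) : Set (Fin n → ℝ) := box Q.center Q.side

/-- The set `ΓQ`: the cube concentric with `Q` whose side length is `Γ` times that of `Q`. -/
def dilate (Γ : ℝ) (Q : Cube n) : Set (Fin n → ℝ) := box Q.center (Γ * Q.side)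

end Cube

variable {n : ℕ}

/-- The average `|Q|⁻¹ μ(Q)` of a positive measure over a cube, `|Q|` being Lebesgue measure. -/
def cubeAverage (μ : Measure (Fin n → ℝ)) (Q : Cube n) : ℝ≥0∞ :=
  μ Q.toSet / volume Q.toSet

/-- The maximal function of a positive measure `μ`: the supremum of the averages of `μ` over the
cubes of `𝒫ⁿ` that contain `x`. -/
def maximal (μ : Measure (Fin n → ℝ)) (x : Fin n → ℝ) : ℝ≥0∞ :=
  ⨆ (Q : Cube n) (_ : x ∈ Q.toSet), cubeAverage μ Q

/-- The maximal function `ℳ(fσ)` of the signed measure `fσ`, that is, the maximal function of its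
total variation `|fσ| = |f|σ`. -/
def maximalMul (f : (Fin n → ℝ) → ℝ) (σ : Measure (Fin n → ℝ)) (x : Fin n → ℝ) : ℝ≥0∞ :=
  maximal (σ.withDensity fun y => ‖f y‖ₑ) x

/-- The best constant `𝔑(σ, ω)` in
`∫ ℳ(fσ)² dω ≤ 𝔑² ∫ |f|² dσ` for all `f ∈ L²(σ)`; it is `∞` if no finite constant exists. -/
def operatorNorm (σ ω : Measure (Fin n → ℝ)) : ℝ≥0∞ :=
  sInf {C : ℝ≥0∞ | ∀ f : (Fin n → ℝ) → ℝ, MemLp f 2 σ →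
    ∫⁻ x, maximalMul f σ x ^ 2 ∂ω ≤ C ^ 2 * ∫⁻ x, ‖f x‖ₑ ^ 2 ∂σ}

/-- The best constant `𝔗(Γ)(σ, ω)` in the `Γ`-testing condition
`∫_Q ℳ(1_Q σ)² dω ≤ 𝔗² σ(ΓQ)` for all `Q ∈ 𝒫ⁿ`; it is `∞` if no finite constant exists.
The measure `1_Q σ` is the restriction of `σ` to `Q`. -/
def testingConstant (Γ : ℝ) (σ ω : Measure (Fin n → ℝ)) : ℝ≥0∞ :=
  sInf {C : ℝ≥0∞ | ∀ Q : Cube n,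
    ∫⁻ x in Q.toSet, maximal (σ.restrict Q.toSet) x ^ 2 ∂ω ≤ C ^ 2 * σ (Q.dilate Γ)}

/-- The Muckenhoupt characteristic `A₂(σ, ω)`. -/
def muckenhouptA2 (σ ω : Measure (Fin n → ℝ)) : ℝ≥0∞ :=
  ⨆ Q : Cube n, cubeAverage σ Q * cubeAverage ω Q

end RestrictedTesting

end

/-!
The lower bound comes from applying the norm inequality to the indicator function of a cube.

For the upper bound let `g = |f|`. Every cube `P ∋ x` of the collection lies in a comparable cell
`P'` of one of `3 ^ n` shifted dyadic grids, and the grid can be chosen so that, in addition, `x` is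
deep inside the ancestor `Q` of `P'` lying a fixed number `m` of scales above
(`exists_isDeep_isDeep`). The average of `gσ` over `P` is then at most a constant times
`E_{P'} g * σ(P') / |P'|`, where `E` denotes `σ`-averages. Two cases are distinguished
(`cubeAverage_withDensity_sq_le`).

* If `E_{P'} g ≥ 2 E_Q g`, the average jumps between the two scales, and
  `(E_{P'} g)² σ(P')` is at most four times the square integral over `P'` of the difference of the
  two averages. These differences are square summable over all scales by orthogonality
  (`tsum_lintegral_jump_le`), and the `A₂` condition turns the squared density of `σ` on `P'`,
  integrated against `ω`, into `σ(P')` (`lintegral_mul_cubeAverage_sq_le`).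
* Otherwise `E_{P'} g < 2 E_Q g ~ 2 ^ i`. Now `Q` is contained in the superlevel set `U_i` of the
  dyadic maximal function, and since `x` is deep in `Q`, the cell `P'` lies in the Whitney cell `W`
  of `U_i` around `x`. Hence `σ(P') / |P'| ≤ ℳ(1_W σ)(x)`, and testing on `W` costs `σ(ΓW)`. It is
  here that the dilates in the testing condition are harmless: the sets `ΓW` stay inside `U_i` and
  overlap boundedly (`lintegral_le_of_isWhitneyScale`), so that they add up to a multiple of
  `σ(U_i)`. The sum of `4 ^ i σ(U_i)` is controlled by the maximal theorem for the grid
  (`tsum_four_zpow_mul_measure_superlevel_le`).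

The suprema over uncountably many cubes are only ever estimated pointwise, by measurable functions
built from the countably many cells of the grids.
-/

noncomputable section

namespace RestrictedTesting

/-! ### Cubes -/

lemma mem_box {n : ℕ} {c : Fin n → ℝ} {ℓ : ℝ} {x : Fin n → ℝ} :
    x ∈ box c ℓ ↔ ∀ i, c i - ℓ / 2 ≤ x i ∧ x i < c i + ℓ / 2 := by
  simp [box]

lemma measurableSet_box {n : ℕ} (c : Fin n → ℝ) (ℓ : ℝ) : MeasurableSet (box c ℓ) :=
  MeasurableSet.univ_pi fun _ => measurableSet_Ico

lemma Cube.measurableSet_toSet {n : ℕ} (Q : Cube n) : MeasurableSet Q.toSet :=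
  measurableSet_box _ _

lemma Cube.side_pos {n : ℕ} (Q : Cube n) : 0 < Q.side := by
  unfold Cube.side; positivity

lemma Cube.toSet_subset_dilate {n : ℕ} (Q : Cube n) {Γ : ℝ} (hΓ : 1 ≤ Γ) :
    Q.toSet ⊆ Q.dilate Γ := by
  intro x hx
  have := Q.side_pos
  rw [Cube.toSet, mem_box] at hx
  rw [Cube.dilate, mem_box]
  intro i
  have h2 : Q.side ≤ Γ * Q.side := by nlinarith
  constructor <;> linarith [(hx i).1, (hx i).2]

lemma Cube.volume_toSet {n : ℕ} (Q : Cube n) :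
    volume Q.toSet = ENNReal.ofReal (2 ^ Q.scale) ^ n := by
  rw [Cube.toSet, box, volume_pi_pi]
  simp [Cube.side]

lemma Cube.measure_toSet_ne_top {n : ℕ} (Q : Cube n) (σ : Measure (Fin n → ℝ))
    [IsLocallyFiniteMeasure σ] : σ Q.toSet ≠ ⊤ := by
  have hs : Q.toSet ⊆ Set.Icc (fun i => Q.center i - Q.side / 2)
      (fun i => Q.center i + Q.side / 2) := by
    intro x hx
    rw [Cube.toSet, mem_box] at hx
    exact ⟨fun i => (hx i).1, fun i => (hx i).2.le⟩
  exact ((measure_mono hs).trans_lt isCompact_Icc.measure_lt_top).ne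

lemma cubeAverage_le_maximal {n : ℕ} (μ : Measure (Fin n → ℝ)) {Q : Cube n} {x : Fin n → ℝ}
    (hx : x ∈ Q.toSet) : cubeAverage μ Q ≤ maximal μ x :=
  le_iSup₂ (f := fun (Q : Cube n) (_ : x ∈ Q.toSet) => cubeAverage μ Q) Q hx

lemma cubeAverage_mul_le_muckenhouptA2 {n : ℕ} (σ ω : Measure (Fin n → ℝ)) (Q : Cube n) :
    cubeAverage σ Q * cubeAverage ω Q ≤ muckenhouptA2 σ ω :=
  le_iSup (fun Q : Cube n => cubeAverage σ Q * cubeAverage ω Q) Q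

lemma cubeAverage_sq_mul_le {n : ℕ} (σ ω : Measure (Fin n → ℝ)) (Q : Cube n) :
    cubeAverage σ Q ^ 2 * ω Q.toSet ≤ muckenhouptA2 σ ω * σ Q.toSet := by
  calc cubeAverage σ Q ^ 2 * ω Q.toSet = (cubeAverage σ Q * cubeAverage ω Q) * σ Q.toSet := by
        simp only [cubeAverage, div_eq_mul_inv]; ring
    _ ≤ _ := by gcongr; exact cubeAverage_mul_le_muckenhouptA2 σ ω Q

/-! ### Shifted dyadic grids -/

/-- The `i`-th coordinate of `x` in the grid with shift parameter `t`, in units of the side length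
`2 ^ k`. The shift `(-1) ^ k * 2 ^ k * t / 3` alternates in sign with the scale, which makes the
cells of consecutive scales nested although the shift is a third of the side length. -/
def gridCoord {n : ℕ} (t : Fin n → Fin 3) (k : ℤ) (x : Fin n → ℝ) (i : Fin n) : ℝ :=
  x i / 2 ^ k - (-1) ^ k * ((t i : ℕ) : ℝ) / 3

/-- The index of the cell of scale `k` of the grid `t` that contains `x`. -/
def gridIndex {n : ℕ} (t : Fin n → Fin 3) (k : ℤ) (x : Fin n → ℝ) : Fin n → ℤ :=
  fun i => ⌊gridCoord t k x i⌋

/-- The cell of side length `2 ^ k` and index `j` of the grid `t`. -/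
def gridCell {n : ℕ} (t : Fin n → Fin 3) (k : ℤ) (j : Fin n → ℤ) : Cube n where
  center := fun i => 2 ^ k * ((j i : ℝ) + 1 / 2 + (-1) ^ k * ((t i : ℕ) : ℝ) / 3)
  scale := k

/-- The cell of scale `k` of the grid `t` that contains `x`. -/
def cellAt {n : ℕ} (t : Fin n → Fin 3) (k : ℤ) (x : Fin n → ℝ) : Cube n :=
  gridCell t k (gridIndex t k x)

lemma sub_center_gridCell {n : ℕ} (t : Fin n → Fin 3) (k : ℤ) (j : Fin n → ℤ) (x : Fin n → ℝ)
    (i : Fin n) :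
    x i - (gridCell t k j).center i = 2 ^ k * (gridCoord t k x i - j i - 1 / 2) := by
  have : (2 : ℝ) ^ k ≠ 0 := by positivity
  simp only [gridCell, gridCoord]
  field_simp
  ring

lemma mem_gridCell {n : ℕ} {t : Fin n → Fin 3} {k : ℤ} {j : Fin n → ℤ} {x : Fin n → ℝ} :
    x ∈ (gridCell t k j).toSet ↔ gridIndex t k x = j := by
  rw [Cube.toSet, mem_box, funext_iff]
  refine forall_congr' fun i => ?_
  have h := sub_center_gridCell t k j x i
  have h2 : (0 : ℝ) < 2 ^ k := by positivity
  have h3 : (gridCell t k j).side = 2 ^ k := rfl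
  rw [gridIndex, Int.floor_eq_iff, h3]
  constructor
  · rintro ⟨h4, h5⟩
    constructor <;> nlinarith
  · rintro ⟨h4, h5⟩
    constructor <;> nlinarith

lemma mem_cellAt {n : ℕ} {t : Fin n → Fin 3} {k : ℤ} {x y : Fin n → ℝ} :
    y ∈ (cellAt t k x).toSet ↔ gridIndex t k y = gridIndex t k x := mem_gridCell

lemma self_mem_cellAt {n : ℕ} (t : Fin n → Fin 3) (k : ℤ) (x : Fin n → ℝ) :
    x ∈ (cellAt t k x).toSet := mem_cellAt.2 rfl

lemma gridIndex_add_one_congr {n : ℕ} {t : Fin n → Fin 3} {k : ℤ} {x y : Fin n → ℝ}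
    (h : gridIndex t k x = gridIndex t k y) : gridIndex t (k + 1) x = gridIndex t (k + 1) y := by
  have key : ∀ z : Fin n → ℝ, ∀ i, ∃ s : ℤ, ((-1 : ℝ) ^ k = s) ∧
      gridIndex t (k + 1) z i = (gridIndex t k z i + s * (t i : ℕ)) / 2 := by
    intro z i
    have hk : (-1 : ℝ) ^ k = 1 ∨ (-1 : ℝ) ^ k = -1 := by
      rcases Int.even_or_odd k with h | h
      · exact Or.inl h.neg_one_zpow
      · exact Or.inr h.neg_one_zpow
    obtain ⟨s, hs⟩ : ∃ s : ℤ, (-1 : ℝ) ^ k = s := by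
      rcases hk with h | h
      · exact ⟨1, by simp [h]⟩
      · exact ⟨-1, by simp [h]⟩
    refine ⟨s, hs, ?_⟩
    have e : gridCoord t (k + 1) z i
        = (gridCoord t k z i + ((s * (t i : ℕ) : ℤ) : ℝ)) / ((2 : ℕ) : ℝ) := by
      simp only [gridCoord]
      rw [zpow_add_one₀ (by norm_num), zpow_add_one₀ (by norm_num), hs]
      push_cast
      have : (2 : ℝ) ^ k ≠ 0 := by positivity
      field_simp
      ring
    rw [gridIndex, gridIndex, e, Int.floor_div_natCast, Int.floor_add_intCast]
    rfl
  ext i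
  obtain ⟨s, hs, h1⟩ := key x i
  obtain ⟨s', hs', h2⟩ := key y i
  have : s = s' := by exact_mod_cast hs.symm.trans hs'
  rw [h1, h2, h, this]

lemma gridIndex_congr_of_le {n : ℕ} {t : Fin n → Fin 3} {k l : ℤ} (hkl : k ≤ l)
    {x y : Fin n → ℝ} (h : gridIndex t k x = gridIndex t k y) :
    gridIndex t l x = gridIndex t l y := by
  induction l, hkl using Int.leInduction with
  | base => exact h
  | succ m _ ih => exact gridIndex_add_one_congr ih

lemma measurable_gridCoord {n : ℕ} (t : Fin n → Fin 3) (k : ℤ) (i : Fin n) :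
    Measurable fun x => gridCoord t k x i := by
  unfold gridCoord; fun_prop

lemma measurable_gridIndex {n : ℕ} (t : Fin n → Fin 3) (k : ℤ) : Measurable (gridIndex t k) :=
  measurable_pi_lambda _ fun i => (measurable_gridCoord t k i).floor

/-- `x` is deep in its cell of scale `k` if its distance to the boundary of that cell is at least an
eighth of the side length. -/
def IsDeep {n : ℕ} (t : Fin n → Fin 3) (k : ℤ) (x : Fin n → ℝ) : Prop :=
  ∀ i, 1 / 8 ≤ Int.fract (gridCoord t k x i) ∧ Int.fract (gridCoord t k x i) ≤ 7 / 8

lemma measurableSet_isDeep {n : ℕ} (t : Fin n → Fin 3) (k : ℤ) :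
    MeasurableSet {x | IsDeep t k x} := by
  simp only [IsDeep, Set.ofPred_forall]
  refine MeasurableSet.iInter fun i => ?_
  have h := (measurable_gridCoord t k i).fract
  exact (measurableSet_le measurable_const h).inter (measurableSet_le h measurable_const)

lemma IsDeep.gridIndex_eq {n : ℕ} {t : Fin n → Fin 3} {k : ℤ} {x y : Fin n → ℝ}
    (hx : IsDeep t k x) (hy : ∀ i, |y i - x i| < 2 ^ k / 8) :
    gridIndex t k y = gridIndex t k x := by
  ext i
  have h1 := hx i
  have h2 := abs_lt.1 (hy i)
  have h3 : (0 : ℝ) < 2 ^ k := by positivity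
  have h4 : gridCoord t k y i - gridCoord t k x i = (y i - x i) / 2 ^ k := by
    simp only [gridCoord]; ring
  have h5 : (y i - x i) / 2 ^ k < 1 / 8 := by rw [div_lt_iff₀ h3]; linarith
  have h6 : -(1 / 8) < (y i - x i) / 2 ^ k := by rw [lt_div_iff₀ h3]; linarith
  have h7 := Int.floor_add_fract (gridCoord t k x i)
  simp only [gridIndex]
  rw [Int.floor_eq_iff]
  constructor <;> linarith

/-- At a given scale, two different shifts cannot both place a coordinate near an integer, since the
shifts differ by a third modulo one. -/
lemma eq_of_fract_near {u s : ℝ} (hs : s = 1 ∨ s = -1) {a b : Fin 3}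
    (ha : ¬ (1 / 8 ≤ Int.fract (u - s * ((a : ℕ) : ℝ) / 3) ∧
      Int.fract (u - s * ((a : ℕ) : ℝ) / 3) ≤ 7 / 8))
    (hb : ¬ (1 / 8 ≤ Int.fract (u - s * ((b : ℕ) : ℝ) / 3) ∧
      Int.fract (u - s * ((b : ℕ) : ℝ) / 3) ≤ 7 / 8)) : a = b := by
  have near : ∀ v : ℝ, ¬ (1 / 8 ≤ Int.fract v ∧ Int.fract v ≤ 7 / 8) →
      ∃ z : ℤ, |v - z| < 1 / 8 := by
    intro v hv
    have h1 := Int.floor_add_fract v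
    have h2 := Int.fract_nonneg v
    have h3 := Int.fract_lt_one v
    by_cases h : 1 / 8 ≤ Int.fract v
    · have h4 : 7 / 8 < Int.fract v := by
        by_contra h5
        exact hv ⟨h, not_lt.1 h5⟩
      refine ⟨⌊v⌋ + 1, ?_⟩
      push_cast
      rw [abs_lt]; constructor <;> linarith
    · refine ⟨⌊v⌋, ?_⟩
      rw [abs_lt]; constructor <;> linarith
  obtain ⟨z, hz⟩ := near _ ha
  obtain ⟨w, hw⟩ := near _ hb
  rw [abs_lt] at hz hw
  obtain ⟨e, he⟩ : ∃ e : ℤ, s = e ∧ (e = 1 ∨ e = -1) := by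
    rcases hs with h | h
    · exact ⟨1, by simp [h]⟩
    · exact ⟨-1, by simp [h]⟩
  have h1 : ((3 * (z - w) + e * ((a : ℕ) - (b : ℕ)) : ℤ) : ℝ) < 1 := by
    push_cast; rw [← he.1]; linarith
  have h2 : (-1 : ℝ) < ((3 * (z - w) + e * ((a : ℕ) - (b : ℕ)) : ℤ) : ℝ) := by
    push_cast; rw [← he.1]; linarith
  have h3 : 3 * (z - w) + e * ((a : ℕ) - (b : ℕ)) < 1 := by exact_mod_cast h1
  have h4 : -1 < 3 * (z - w) + e * ((a : ℕ) - (b : ℕ)) := by exact_mod_cast h2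
  have := a.2
  have := b.2
  apply Fin.ext
  rcases he.2 with h | h <;> subst h <;> omega

/-- Among the three shifts per coordinate, each of two given scales excludes at most one: some grid
has `x` deep in its cells of both scales. -/
lemma exists_isDeep_isDeep {n : ℕ} (k l : ℤ) (x : Fin n → ℝ) :
    ∃ t : Fin n → Fin 3, IsDeep t k x ∧ IsDeep t l x := by
  have sgn : ∀ k : ℤ, (-1 : ℝ) ^ k = 1 ∨ (-1 : ℝ) ^ k = -1 := by
    intro k
    rcases Int.even_or_odd k with h | h
    · exact Or.inl h.neg_one_zpow
    · exact Or.inr h.neg_one_zpow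
  have key : ∀ i, ∃ a : Fin 3, ∀ r, r = k ∨ r = l →
      1 / 8 ≤ Int.fract (x i / 2 ^ r - (-1) ^ r * ((a : ℕ) : ℝ) / 3) ∧
      Int.fract (x i / 2 ^ r - (-1) ^ r * ((a : ℕ) : ℝ) / 3) ≤ 7 / 8 := by
    intro i
    by_contra hcon
    have bad : ∀ a : Fin 3, ∃ r, (r = k ∨ r = l) ∧
        ¬ (1 / 8 ≤ Int.fract (x i / 2 ^ r - (-1) ^ r * ((a : ℕ) : ℝ) / 3) ∧
        Int.fract (x i / 2 ^ r - (-1) ^ r * ((a : ℕ) : ℝ) / 3) ≤ 7 / 8) := by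
      intro a
      by_contra h
      refine hcon ⟨a, fun r hr => ?_⟩
      by_contra h2
      exact h ⟨r, hr, h2⟩
    choose r hr hbad using bad
    have inj : ∀ a b, r a = r b → a = b := by
      intro a b hab
      refine eq_of_fract_near (sgn (r a)) (hbad a) ?_
      rw [hab]; exact hbad b
    have h01 : r 0 ≠ r 1 := fun h => absurd (inj _ _ h) (by decide)
    have h02 : r 0 ≠ r 2 := fun h => absurd (inj _ _ h) (by decide)
    have h12 : r 1 ≠ r 2 := fun h => absurd (inj _ _ h) (by decide)
    rcases hr 0 with a | a <;> rcases hr 1 with b | b <;> rcases hr 2 with c | c <;>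
      simp_all
  choose t ht using key
  exact ⟨t, fun i => ht i k (Or.inl rfl), fun i => ht i l (Or.inr rfl)⟩

/-! ### Averages over grid cells -/

/-- The `σ`-average of `g` over the cell of scale `k` that contains `x`. -/
def gridAverage {n : ℕ} (t : Fin n → Fin 3) (σ : Measure (Fin n → ℝ)) (g : (Fin n → ℝ) → ℝ≥0∞)
    (k : ℤ) (x : Fin n → ℝ) : ℝ≥0∞ :=
  (∫⁻ y in (cellAt t k x).toSet, g y ∂σ) / σ (cellAt t k x).toSet

lemma cellAt_congr {n : ℕ} {t : Fin n → Fin 3} {k : ℤ} {x y : Fin n → ℝ}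
    (h : gridIndex t k x = gridIndex t k y) : cellAt t k x = cellAt t k y := by
  rw [cellAt, cellAt, h]

lemma gridAverage_congr {n : ℕ} {t : Fin n → Fin 3} {σ : Measure (Fin n → ℝ)}
    {g : (Fin n → ℝ) → ℝ≥0∞} {k : ℤ} {x y : Fin n → ℝ}
    (h : gridIndex t k x = gridIndex t k y) : gridAverage t σ g k x = gridAverage t σ g k y := by
  rw [gridAverage, gridAverage, cellAt_congr h]

lemma exists_gridIndex_eq {n : ℕ} (t : Fin n → Fin 3) (k : ℤ) (j : Fin n → ℤ) :
    ∃ x, gridIndex t k x = j := by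
  refine ⟨(gridCell t k j).center, mem_gridCell.1 ?_⟩
  have := (gridCell t k j).side_pos
  rw [Cube.toSet, mem_box]
  intro i
  constructor <;> linarith

/-- A function that is constant on the cells of scale `k` is measurable. -/
lemma measurable_of_gridIndex {n : ℕ} {α : Type*} [MeasurableSpace α] {t : Fin n → Fin 3} {k : ℤ}
    {F : (Fin n → ℝ) → α} (hF : ∀ x y, gridIndex t k x = gridIndex t k y → F x = F y) :
    Measurable F := by
  choose c hc using exists_gridIndex_eq t k
  have : F = (fun j => F (c j)) ∘ gridIndex t k := by
    funext x
    exact hF _ _ (hc _).symm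
  rw [this]
  exact (Measurable.of_discrete).comp (measurable_gridIndex t k)

lemma measurable_gridAverage {n : ℕ} (t : Fin n → Fin 3) (σ : Measure (Fin n → ℝ))
    (g : (Fin n → ℝ) → ℝ≥0∞) (k : ℤ) : Measurable (gridAverage t σ g k) :=
  measurable_of_gridIndex fun _ _ h => gridAverage_congr h

lemma lintegral_eq_tsum_gridCell {n : ℕ} (t : Fin n → Fin 3) (k : ℤ) (μ : Measure (Fin n → ℝ))
    (F : (Fin n → ℝ) → ℝ≥0∞) :
    ∫⁻ x, F x ∂μ = ∑' j, ∫⁻ x in (gridCell t k j).toSet, F x ∂μ := by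
  rw [← lintegral_iUnion (fun j => (gridCell t k j).measurableSet_toSet)]
  · have : (⋃ j, (gridCell t k j).toSet) = Set.univ :=
      Set.eq_univ_of_forall fun x => Set.mem_iUnion.2 ⟨_, self_mem_cellAt t k x⟩
    rw [this, Measure.restrict_univ]
  · intro i j hij
    refine Set.disjoint_left.2 fun x hi hj => hij ?_
    rw [← mem_gridCell.1 hi, ← mem_gridCell.1 hj]

/-- To compare two integrals over the whole space it suffices to compare them over every cell of
one scale. -/
lemma lintegral_le_of_cellAt {n : ℕ} (t : Fin n → Fin 3) (k : ℤ) {μ ν : Measure (Fin n → ℝ)}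
    {F G : (Fin n → ℝ) → ℝ≥0∞}
    (h : ∀ c, ∫⁻ x in (cellAt t k c).toSet, F x ∂μ ≤ ∫⁻ x in (cellAt t k c).toSet, G x ∂ν) :
    ∫⁻ x, F x ∂μ ≤ ∫⁻ x, G x ∂ν := by
  rw [lintegral_eq_tsum_gridCell t k, lintegral_eq_tsum_gridCell t k]
  refine ENNReal.tsum_le_tsum fun j => ?_
  obtain ⟨c, rfl⟩ := exists_gridIndex_eq t k j
  exact h c

lemma gridAverage_mul_measure {n : ℕ} (t : Fin n → Fin 3) (σ : Measure (Fin n → ℝ))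
    [IsLocallyFiniteMeasure σ] (g : (Fin n → ℝ) → ℝ≥0∞) (k : ℤ) (x : Fin n → ℝ) :
    gridAverage t σ g k x * σ (cellAt t k x).toSet = ∫⁻ y in (cellAt t k x).toSet, g y ∂σ := by
  rw [gridAverage]
  refine ENNReal.div_mul_cancel' (fun h => ?_)
    (fun h => absurd h ((cellAt t k x).measure_toSet_ne_top σ))
  exact setLIntegral_measure_zero _ _ h

/-- Over a cell, a function constant on cells integrates to its value times the measure. -/
lemma setLIntegral_cellAt_mul {n : ℕ} {t : Fin n → Fin 3} {k : ℤ} {μ : Measure (Fin n → ℝ)}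
    {F : (Fin n → ℝ) → ℝ≥0∞} (hF : ∀ x y, gridIndex t k x = gridIndex t k y → F x = F y)
    {g : (Fin n → ℝ) → ℝ≥0∞} (hg : Measurable g) (c : Fin n → ℝ) :
    ∫⁻ x in (cellAt t k c).toSet, F x * g x ∂μ = F c * ∫⁻ x in (cellAt t k c).toSet, g x ∂μ := by
  rw [← lintegral_const_mul _ hg]
  refine setLIntegral_congr_fun (cellAt t k c).measurableSet_toSet fun x hx => ?_
  rw [hF x c (mem_cellAt.1 hx)]

/-- The tower property of the averages: against functions constant on cells, `g` may be replaced by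
its averages. -/
lemma lintegral_mul_gridAverage {n : ℕ} {t : Fin n → Fin 3} {k : ℤ} {σ : Measure (Fin n → ℝ)}
    [IsLocallyFiniteMeasure σ]
    {F : (Fin n → ℝ) → ℝ≥0∞} (hF : ∀ x y, gridIndex t k x = gridIndex t k y → F x = F y)
    {g : (Fin n → ℝ) → ℝ≥0∞} (hg : Measurable g) :
    ∫⁻ x, F x * gridAverage t σ g k x ∂σ = ∫⁻ x, F x * g x ∂σ := by
  have key : ∀ c, ∫⁻ x in (cellAt t k c).toSet, F x * gridAverage t σ g k x ∂σ
      = ∫⁻ x in (cellAt t k c).toSet, F x * g x ∂σ := by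
    intro c
    rw [setLIntegral_cellAt_mul hF hg, setLIntegral_cellAt_mul hF (measurable_gridAverage t σ g k),
      ← gridAverage_mul_measure t σ g]
    congr 1
    have := setLIntegral_cellAt_mul (μ := σ) (t := t) (k := k) (F := gridAverage t σ g k)
      (fun _ _ h => gridAverage_congr h) (measurable_const (a := (1 : ℝ≥0∞))) c
    simpa using this
  exact le_antisymm (lintegral_le_of_cellAt t k fun c => (key c).le)
    (lintegral_le_of_cellAt t k fun c => (key c).ge)

/-- Averaging contracts `L²(σ)`, by the Cauchy–Schwarz inequality on each cell. -/
lemma lintegral_gridAverage_sq_le {n : ℕ} (t : Fin n → Fin 3) (σ : Measure (Fin n → ℝ))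
    [IsLocallyFiniteMeasure σ] {g : (Fin n → ℝ) → ℝ≥0∞} (hg : Measurable g) (k : ℤ) :
    ∫⁻ x, gridAverage t σ g k x ^ 2 ∂σ ≤ ∫⁻ x, g x ^ 2 ∂σ := by
  refine lintegral_le_of_cellAt t k fun c => ?_
  set Q := (cellAt t k c).toSet with hQ
  have h1 : ∫⁻ x in Q, gridAverage t σ g k x ^ 2 ∂σ = gridAverage t σ g k c ^ 2 * σ Q := by
    have := setLIntegral_cellAt_mul (μ := σ) (t := t) (k := k)
      (F := fun x => gridAverage t σ g k x ^ 2)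
      (fun _ _ h => by simp only [gridAverage_congr h]) (measurable_const (a := (1 : ℝ≥0∞))) c
    simpa using this
  have h2 : (∫⁻ x in Q, g x ∂σ) ^ 2 ≤ (∫⁻ x in Q, g x ^ 2 ∂σ) * σ Q := by
    have := ENNReal.lintegral_mul_le_Lp_mul_Lq (σ.restrict Q) Real.HolderConjugate.two_two
      hg.aemeasurable (aemeasurable_const (b := (1 : ℝ≥0∞)))
    simp only [Pi.mul_apply, mul_one, lintegral_const, one_mul, one_pow,
      Measure.restrict_apply MeasurableSet.univ, Set.univ_inter, ENNReal.rpow_two] at this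
    calc (∫⁻ x in Q, g x ∂σ) ^ 2
        ≤ ((∫⁻ x in Q, g x ^ 2 ∂σ) ^ (1 / 2 : ℝ) * σ Q ^ (1 / 2 : ℝ)) ^ 2 := by gcongr
      _ = _ := by
        rw [mul_pow, ← ENNReal.rpow_two, ← ENNReal.rpow_two, ← ENNReal.rpow_mul,
          ← ENNReal.rpow_mul]
        norm_num
  rw [h1, gridAverage, ← hQ]
  rcases eq_or_ne (σ Q) 0 with h0 | h0
  · simp [h0]
  have ht : σ Q ≠ ⊤ := (cellAt t k c).measure_toSet_ne_top σ
  calc ((∫⁻ x in Q, g x ∂σ) / σ Q) ^ 2 * σ Q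
      = (∫⁻ x in Q, g x ∂σ) ^ 2 * (σ Q)⁻¹ * ((σ Q)⁻¹ * σ Q) := by
        rw [div_eq_mul_inv]; ring
    _ ≤ (∫⁻ x in Q, g x ^ 2 ∂σ) * σ Q * (σ Q)⁻¹ * ((σ Q)⁻¹ * σ Q) := by gcongr
    _ = _ := by
        rw [ENNReal.inv_mul_cancel h0 ht, mul_one, mul_assoc, ENNReal.mul_inv_cancel h0 ht, mul_one]

/-! ### Scales at which the averages jump -/

/-- The square of the average at scale `k` where this average is at least twice the average at scale
`k + m`, and zero elsewhere. -/
def jump {n : ℕ} (t : Fin n → Fin 3) (σ : Measure (Fin n → ℝ)) (g : (Fin n → ℝ) → ℝ≥0∞)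
    (m : ℕ) (k : ℤ) : (Fin n → ℝ) → ℝ≥0∞ :=
  {x | 2 * gridAverage t σ g (k + m) x ≤ gridAverage t σ g k x}.indicator
    fun x => gridAverage t σ g k x ^ 2

lemma jump_congr {n : ℕ} {t : Fin n → Fin 3} {σ : Measure (Fin n → ℝ)} {g : (Fin n → ℝ) → ℝ≥0∞}
    {m : ℕ} {k : ℤ} {x y : Fin n → ℝ} (h : gridIndex t k x = gridIndex t k y) :
    jump t σ g m k x = jump t σ g m k y := by
  have h' : gridIndex t (k + m) x = gridIndex t (k + m) y := gridIndex_congr_of_le (by omega) h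
  simp only [jump, Set.indicator, Set.mem_ofPred_eq, gridAverage_congr h, gridAverage_congr h']

lemma measurable_jump {n : ℕ} (t : Fin n → Fin 3) (σ : Measure (Fin n → ℝ))
    (g : (Fin n → ℝ) → ℝ≥0∞) (m : ℕ) (k : ℤ) : Measurable (jump t σ g m k) :=
  measurable_of_gridIndex fun _ _ h => jump_congr h

lemma eight_mul_add_indicator_le (a b : ℝ≥0∞) :
    8 * (a * b) + (if 2 * a ≤ b then b ^ 2 else 0) ≤ 4 * a ^ 2 + 4 * b ^ 2 := by
  by_cases ha : a = ⊤
  · simp [ha]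
  by_cases hb : b = ⊤
  · simp [hb]
  lift a to ℝ≥0 using ha
  lift b to ℝ≥0 using hb
  split_ifs with h
  · have h' : 2 * (a : ℝ) ≤ b := by exact_mod_cast h
    have : 8 * ((a : ℝ) * b) + b ^ 2 ≤ 4 * a ^ 2 + 4 * b ^ 2 := by
      nlinarith [a.2, b.2, mul_nonneg (sub_nonneg.2 h') b.2, sq_nonneg ((b : ℝ) - 2 * a)]
    exact_mod_cast this
  · have : 8 * ((a : ℝ) * b) + 0 ≤ 4 * a ^ 2 + 4 * b ^ 2 := by
      nlinarith [sq_nonneg ((b : ℝ) - a)]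
    exact_mod_cast this

/-- Where the averages jump, their difference is at least half the finer one; and the differences
are orthogonal to the coarser averages. -/
lemma lintegral_gridAverage_sq_add_jump_le {n : ℕ} (t : Fin n → Fin 3) (σ : Measure (Fin n → ℝ))
    [IsLocallyFiniteMeasure σ] {g : (Fin n → ℝ) → ℝ≥0∞} (hg : Measurable g)
    (hg2 : ∫⁻ x, g x ^ 2 ∂σ ≠ ⊤) (m : ℕ) (k : ℤ) :
    4 * ∫⁻ x, gridAverage t σ g (k + m) x ^ 2 ∂σ + ∫⁻ x, jump t σ g m k x ∂σ
      ≤ 4 * ∫⁻ x, gridAverage t σ g k x ^ 2 ∂σ := by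
  have ma := measurable_gridAverage t σ g (k + m)
  have mb := measurable_gridAverage t σ g k
  have hab : ∫⁻ x, gridAverage t σ g (k + m) x * gridAverage t σ g k x ∂σ
      = ∫⁻ x, gridAverage t σ g (k + m) x ^ 2 ∂σ := by
    rw [lintegral_mul_gridAverage (fun x y h => gridAverage_congr
      (gridIndex_congr_of_le (by omega) h)) hg]
    simp only [sq]
    rw [lintegral_mul_gridAverage (fun x y h => gridAverage_congr h) hg]
  have hint : 8 * ∫⁻ x, gridAverage t σ g (k + m) x * gridAverage t σ g k x ∂σ
      + ∫⁻ x, jump t σ g m k x ∂σ ≤ 4 * ∫⁻ x, gridAverage t σ g (k + m) x ^ 2 ∂σ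
      + 4 * ∫⁻ x, gridAverage t σ g k x ^ 2 ∂σ := by
    rw [← lintegral_const_mul 8 (f := fun x => gridAverage t σ g (k + m) x * gridAverage t σ g k x)
      (ma.mul mb), ← lintegral_const_mul _ (ma.pow_const 2),
      ← lintegral_const_mul _ (mb.pow_const 2),
      ← lintegral_add_right _ (measurable_jump t σ g m k),
      ← lintegral_add_right _ ((mb.pow_const 2).const_mul 4)]
    refine lintegral_mono fun x => ?_
    have := eight_mul_add_indicator_le (gridAverage t σ g (k + m) x) (gridAverage t σ g k x)
    simpa only [jump, Set.indicator, Set.mem_ofPred_eq] using this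
  rw [hab] at hint
  have hfin : 4 * ∫⁻ x, gridAverage t σ g (k + m) x ^ 2 ∂σ ≠ ⊤ :=
    ENNReal.mul_ne_top (by simp)
      (ne_top_of_le_ne_top hg2 (lintegral_gridAverage_sq_le t σ hg (k + m)))
  rw [show (8 : ℝ≥0∞) = 4 + 4 by norm_num, add_mul, add_assoc] at hint
  exact (ENNReal.add_le_add_iff_left hfin).1 hint

/-- Telescoping over all integers for a bounded sequence in `[0, ∞]`. -/
lemma tsum_le_of_add_le_pred {S X : ℤ → ℝ≥0∞} {B : ℝ≥0∞} (hS : ∀ j, S j ≤ B)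
    (h : ∀ j, S (j + 1) + X j ≤ S j) : ∑' j, X j ≤ B := by
  have key : ∀ (a : ℤ) (N : ℕ), S (a + N) + ∑ i ∈ Finset.range N, X (a + i) ≤ S a := by
    intro a N
    induction N with
    | zero => simp
    | succ N ih =>
      rw [Finset.sum_range_succ]
      calc S (a + (N + 1 : ℕ)) + (∑ i ∈ Finset.range N, X (a + i) + X (a + N))
          = (S (a + N + 1) + X (a + N)) + ∑ i ∈ Finset.range N, X (a + i) := by
            push_cast; rw [← add_assoc a]; ring
        _ ≤ S (a + N) + ∑ i ∈ Finset.range N, X (a + i) := by gcongr; exact h _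
        _ ≤ _ := ih
  rw [ENNReal.tsum_eq_iSup_sum]
  refine iSup_le fun s => ?_
  set N := s.sup Int.natAbs
  have hs : s ⊆ (Finset.range (2 * N + 1)).image fun i : ℕ => -(N : ℤ) + i := by
    intro z hz
    have : z.natAbs ≤ N := Finset.le_sup (f := Int.natAbs) hz
    simp only [Finset.mem_image, Finset.mem_range]
    exact ⟨(z + N).toNat, by omega, by omega⟩
  calc ∑ j ∈ s, X j ≤ ∑ j ∈ (Finset.range (2 * N + 1)).image fun i : ℕ => -(N : ℤ) + i, X j :=
        Finset.sum_le_sum_of_subset hs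
    _ = ∑ i ∈ Finset.range (2 * N + 1), X (-(N : ℤ) + i) :=
        Finset.sum_image fun a _ b _ h => by simpa using h
    _ ≤ S (-(N : ℤ)) := le_add_self.trans (key _ _)
    _ ≤ B := hS _

/-- The jumps at all scales are square summable: along each residue class of scales modulo `m` the
bounds telescope. -/
lemma tsum_lintegral_jump_le {n : ℕ} (t : Fin n → Fin 3) (σ : Measure (Fin n → ℝ))
    [IsLocallyFiniteMeasure σ] {g : (Fin n → ℝ) → ℝ≥0∞} (hg : Measurable g)
    (hg2 : ∫⁻ x, g x ^ 2 ∂σ ≠ ⊤) (m : ℕ) [NeZero m] :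
    ∑' k, ∫⁻ x, jump t σ g m k x ∂σ ≤ m * (4 * ∫⁻ x, g x ^ 2 ∂σ) := by
  rw [← (Int.divModEquiv m).symm.tsum_eq, ENNReal.tsum_prod', ENNReal.tsum_comm]
  calc _ ≤ ∑' _ : Fin m, 4 * ∫⁻ x, g x ^ 2 ∂σ := by
        refine ENNReal.tsum_le_tsum fun r => ?_
        refine tsum_le_of_add_le_pred
          (S := fun j => 4 * ∫⁻ x, gridAverage t σ g ((Int.divModEquiv m).symm (j, r)) x ^ 2 ∂σ)
          (fun j => ?_) (fun j => ?_)
        · exact mul_le_mul_right (lintegral_gridAverage_sq_le t σ hg _) 4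
        · have := lintegral_gridAverage_sq_add_jump_le t σ hg hg2 m
            ((Int.divModEquiv m).symm (j, r))
          have e : (Int.divModEquiv m).symm (j + 1, r) = (Int.divModEquiv m).symm (j, r) + m := by
            simp [Int.divModEquiv]; ring
          simp only [e]
          exact this
    _ = _ := by simp

/-- The `A₂` condition transfers the integral of a function constant on cells from `σ` to `ω`, at
the cost of the squared density of `σ` on the cells. -/
lemma lintegral_mul_cubeAverage_sq_le {n : ℕ} {t : Fin n → Fin 3} {k : ℤ}
    {σ ω : Measure (Fin n → ℝ)} {F : (Fin n → ℝ) → ℝ≥0∞}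
    (hF : ∀ x y, gridIndex t k x = gridIndex t k y → F x = F y) :
    ∫⁻ x, F x * cubeAverage σ (cellAt t k x) ^ 2 ∂ω ≤ muckenhouptA2 σ ω * ∫⁻ x, F x ∂σ := by
  have mF : Measurable F := measurable_of_gridIndex hF
  rw [← lintegral_const_mul _ mF]
  refine lintegral_le_of_cellAt t k fun c => ?_
  have h1 := setLIntegral_cellAt_mul (μ := ω) (t := t) (k := k)
    (F := fun x => F x * cubeAverage σ (cellAt t k x) ^ 2)
    (fun x y h => by simp only [hF x y h, cellAt_congr h]) (measurable_const (a := (1 : ℝ≥0∞))) c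
  have h2 := setLIntegral_cellAt_mul (μ := σ) (t := t) (k := k)
    hF (measurable_const (a := muckenhouptA2 σ ω)) c
  simp only [mul_one, lintegral_const, one_mul, Measure.restrict_apply MeasurableSet.univ,
    Set.univ_inter] at h1 h2
  simp only [mul_comm (muckenhouptA2 σ ω)]
  rw [h1, h2, mul_assoc]
  refine mul_le_mul_right ?_ _
  exact cubeAverage_sq_mul_le σ ω _

/-! ### The dyadic maximal function -/

/-- The set where some average of `g` at a scale at most `L` is at least `a`. -/
def superlevel {n : ℕ} (t : Fin n → Fin 3) (σ : Measure (Fin n → ℝ)) (g : (Fin n → ℝ) → ℝ≥0∞)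
    (L : ℤ) (a : ℝ≥0∞) : Set (Fin n → ℝ) :=
  {x | ∃ k ≤ L, a ≤ gridAverage t σ g k x}

lemma measurableSet_superlevel {n : ℕ} (t : Fin n → Fin 3) (σ : Measure (Fin n → ℝ))
    (g : (Fin n → ℝ) → ℝ≥0∞) (L : ℤ) (a : ℝ≥0∞) : MeasurableSet (superlevel t σ g L a) := by
  have : superlevel t σ g L a = ⋃ k : ℤ, ⋃ _ : k ≤ L, {x | a ≤ gridAverage t σ g k x} := by
    ext x; simp [superlevel]
  rw [this]
  exact MeasurableSet.iUnion fun k => MeasurableSet.iUnion fun _ =>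
    measurableSet_le measurable_const (measurable_gridAverage t σ g k)

/-- The part of the superlevel set on which `k` is the largest admissible scale. -/
def superlevelAt {n : ℕ} (t : Fin n → Fin 3) (σ : Measure (Fin n → ℝ)) (g : (Fin n → ℝ) → ℝ≥0∞)
    (L : ℤ) (a : ℝ≥0∞) (k : ℤ) : Set (Fin n → ℝ) :=
  {x | k ≤ L ∧ a ≤ gridAverage t σ g k x ∧ ∀ l ≤ L, a ≤ gridAverage t σ g l x → l ≤ k}

lemma superlevel_subset_iUnion {n : ℕ} (t : Fin n → Fin 3) (σ : Measure (Fin n → ℝ))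
    (g : (Fin n → ℝ) → ℝ≥0∞) (L : ℤ) (a : ℝ≥0∞) :
    superlevel t σ g L a ⊆ ⋃ k, superlevelAt t σ g L a k := by
  rintro x ⟨k, hk, hx⟩
  obtain ⟨l, hl, hmax⟩ := Int.exists_greatest_of_bdd
    (P := fun l => l ≤ L ∧ a ≤ gridAverage t σ g l x) ⟨L, fun z hz => hz.1⟩ ⟨k, hk, hx⟩
  exact Set.mem_iUnion.2 ⟨l, hl.1, hl.2, fun l' h1 h2 => hmax l' ⟨h1, h2⟩⟩

lemma superlevelAt_congr {n : ℕ} {t : Fin n → Fin 3} {σ : Measure (Fin n → ℝ)}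
    {g : (Fin n → ℝ) → ℝ≥0∞} {L : ℤ} {a : ℝ≥0∞} {k : ℤ} {x y : Fin n → ℝ}
    (h : gridIndex t k x = gridIndex t k y) :
    (x ∈ superlevelAt t σ g L a k ↔ y ∈ superlevelAt t σ g L a k) := by
  have aux : ∀ x y : Fin n → ℝ, gridIndex t k x = gridIndex t k y →
      x ∈ superlevelAt t σ g L a k → y ∈ superlevelAt t σ g L a k := by
    rintro x y h ⟨h1, h2, h3⟩
    refine ⟨h1, by rwa [← gridAverage_congr h], fun l hl hal => ?_⟩
    by_contra hkl
    push Not at hkl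
    refine hkl.not_ge (h3 l hl ?_)
    rwa [gridAverage_congr (gridIndex_congr_of_le hkl.le h)]
  exact ⟨aux x y h, aux y x h.symm⟩

lemma measurableSet_superlevelAt {n : ℕ} (t : Fin n → Fin 3) (σ : Measure (Fin n → ℝ))
    (g : (Fin n → ℝ) → ℝ≥0∞) (L : ℤ) (a : ℝ≥0∞) (k : ℤ) :
    MeasurableSet (superlevelAt t σ g L a k) := by
  have : Measurable fun x => x ∈ superlevelAt t σ g L a k :=
    measurable_of_gridIndex fun _ _ h => propext (superlevelAt_congr h)
  exact measurableSet_setOfPred.2 this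

/-- The weak type inequality for the dyadic maximal function; since values of `g` up to `a` cannot
raise an average above `a`, only the larger values count. -/
lemma mul_measure_superlevel_le {n : ℕ} (t : Fin n → Fin 3) (σ : Measure (Fin n → ℝ))
    [IsLocallyFiniteMeasure σ] {g : (Fin n → ℝ) → ℝ≥0∞} (hg : Measurable g) (L : ℤ) {a : ℝ≥0∞}
    (ha : a ≠ ⊤) :
    a * σ (superlevel t σ g L (2 * a)) ≤ ∫⁻ x in {x | a < g x}, g x ∂σ := by
  have mG : MeasurableSet {x | a < g x} := measurableSet_lt measurable_const hg
  have cell : ∀ k c, 2 * a ≤ gridAverage t σ g k c → a * σ (cellAt t k c).toSet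
      ≤ ∫⁻ x in (cellAt t k c).toSet, {x | a < g x}.indicator g x ∂σ := by
    intro k c hc
    set Q := (cellAt t k c).toSet with hQ
    have hfin : a * σ Q ≠ ⊤ := ENNReal.mul_ne_top ha ((cellAt t k c).measure_toSet_ne_top σ)
    have h1 : 2 * a * σ Q ≤ ∫⁻ x in Q, g x ∂σ := by
      rw [hQ, ← gridAverage_mul_measure]
      gcongr
    have h2 : ∫⁻ x in Q, g x ∂σ ≤ a * σ Q + ∫⁻ x in Q, {x | a < g x}.indicator g x ∂σ := by
      calc ∫⁻ x in Q, g x ∂σ ≤ ∫⁻ x in Q, (a + {x | a < g x}.indicator g x) ∂σ := by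
            refine lintegral_mono fun x => ?_
            by_cases hx : a < g x
            · simp [Set.indicator, hx]
            · simp [Set.indicator, hx, not_lt.1 hx]
        _ = _ := by
            rw [lintegral_add_left measurable_const]; simp
    rw [two_mul, add_mul] at h1
    exact (ENNReal.add_le_add_iff_left hfin).1 (h1.trans h2)
  have part : ∀ k, a * σ (superlevelAt t σ g L (2 * a) k)
      ≤ ∫⁻ x in superlevelAt t σ g L (2 * a) k, {x | a < g x}.indicator g x ∂σ := by
    intro k
    have mS := measurableSet_superlevelAt t σ g L (2 * a) k
    rw [← lintegral_indicator mS, ← setLIntegral_const, ← lintegral_indicator mS]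
    refine lintegral_le_of_cellAt t k fun c => ?_
    by_cases hc : c ∈ superlevelAt t σ g L (2 * a) k
    · have hmem : ∀ x ∈ (cellAt t k c).toSet, x ∈ superlevelAt t σ g L (2 * a) k :=
        fun x hx => (superlevelAt_congr (mem_cellAt.1 hx)).2 hc
      have h1 : ∫⁻ x in (cellAt t k c).toSet, (superlevelAt t σ g L (2 * a) k).indicator
          (fun _ => a) x ∂σ = a * σ (cellAt t k c).toSet := by
        rw [← setLIntegral_const]
        refine setLIntegral_congr_fun (cellAt t k c).measurableSet_toSet fun x hx => ?_
        simp [Set.indicator, hmem x hx]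
      rw [h1]
      refine (cell k c hc.2.1).trans (le_of_eq ?_)
      refine setLIntegral_congr_fun (cellAt t k c).measurableSet_toSet fun x hx => ?_
      simp [Set.indicator, hmem x hx]
    · have hmem : ∀ x ∈ (cellAt t k c).toSet, x ∉ superlevelAt t σ g L (2 * a) k :=
        fun x hx h => hc ((superlevelAt_congr (mem_cellAt.1 hx)).1 h)
      have h1 : ∫⁻ x in (cellAt t k c).toSet, (superlevelAt t σ g L (2 * a) k).indicator
          (fun _ => a) x ∂σ = ∫⁻ x in (cellAt t k c).toSet, 0 ∂σ := by
        refine setLIntegral_congr_fun (cellAt t k c).measurableSet_toSet fun x hx => ?_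
        simp [Set.indicator, hmem x hx]
      rw [h1]
      simp
  calc a * σ (superlevel t σ g L (2 * a))
      ≤ a * ∑' k, σ (superlevelAt t σ g L (2 * a) k) := by
        gcongr
        exact (measure_mono (superlevel_subset_iUnion t σ g L (2 * a))).trans
          (measure_iUnion_le _)
    _ = ∑' k, a * σ (superlevelAt t σ g L (2 * a) k) := ENNReal.tsum_mul_left.symm
    _ ≤ ∑' k, ∫⁻ x in superlevelAt t σ g L (2 * a) k, {x | a < g x}.indicator g x ∂σ :=
        ENNReal.tsum_le_tsum part
    _ = ∫⁻ x in ⋃ k, superlevelAt t σ g L (2 * a) k, {x | a < g x}.indicator g x ∂σ := by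
        rw [lintegral_iUnion (measurableSet_superlevelAt t σ g L (2 * a))]
        intro k l hkl
        refine Set.disjoint_left.2 fun x hk hl => hkl ?_
        exact le_antisymm (hl.2.2 k hk.1 hk.2.1) (hk.2.2 l hl.1 hl.2.1)
    _ ≤ ∫⁻ x, {x | a < g x}.indicator g x ∂σ := setLIntegral_le_lintegral _ _
    _ = _ := lintegral_indicator mG g

lemma two_zpow_add_one (i : ℤ) : (2 : ℝ≥0∞) ^ (i + 1) = 2 * 2 ^ i := by
  rw [ENNReal.zpow_add (by norm_num) (by norm_num), zpow_one, mul_comm]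

lemma four_zpow (i : ℤ) : (4 : ℝ≥0∞) ^ i = 2 ^ i * 2 ^ i := by
  have h2 : (2 : ℝ≥0∞) = ((2 : ℝ≥0) : ℝ≥0∞) := by norm_num
  have h4 : (4 : ℝ≥0∞) = ((4 : ℝ≥0) : ℝ≥0∞) := by norm_num
  rw [h2, h4, ← ENNReal.coe_zpow (by norm_num), ← ENNReal.coe_zpow (by norm_num),
    ← ENNReal.coe_mul, ← mul_zpow]
  norm_num

lemma tsum_two_zpow_lt_le (b : ℝ≥0∞) :
    ∑' i : ℤ, (if (2 : ℝ≥0∞) ^ i < b then (2 : ℝ≥0∞) ^ i else 0) ≤ 2 * b := by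
  rw [← (Equiv.neg ℤ).tsum_eq]
  -- The sum telescopes against `min (2 ^ i) (2 * b)`, here reflected because the lemma descends.
  refine tsum_le_of_add_le_pred (S := fun j => min (2 ^ (-j + 1)) (2 * b))
    (fun j => min_le_right _ _) fun j => ?_
  simp only [Equiv.neg_apply, show -(j + 1) + 1 = -j by ring, two_zpow_add_one]
  split_ifs with h
  · refine le_min ?_ ?_
    · rw [two_mul ((2 : ℝ≥0∞) ^ (-j))]; gcongr; exact min_le_left _ _
    · rw [two_mul b]; gcongr; exact (min_le_left _ _).trans h.le
  · rw [add_zero]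
    exact min_le_min_right _ (by rw [two_mul ((2 : ℝ≥0∞) ^ (-j))]; exact le_self_add)

/-- The maximal theorem for one grid, in the form of a sum over superlevel sets. -/
lemma tsum_four_zpow_mul_measure_superlevel_le {n : ℕ} (t : Fin n → Fin 3)
    (σ : Measure (Fin n → ℝ)) [IsLocallyFiniteMeasure σ] {g : (Fin n → ℝ) → ℝ≥0∞}
    (hg : Measurable g) (L : ℤ) :
    ∑' i : ℤ, (4 : ℝ≥0∞) ^ i * σ (superlevel t σ g L (2 ^ i)) ≤ 8 * ∫⁻ x, g x ^ 2 ∂σ := by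
  have two0 : (2 : ℝ≥0∞) ≠ 0 := by norm_num
  have twoT : (2 : ℝ≥0∞) ≠ ⊤ := by norm_num
  calc ∑' i : ℤ, (4 : ℝ≥0∞) ^ i * σ (superlevel t σ g L (2 ^ i))
      = ∑' i : ℤ, (4 : ℝ≥0∞) ^ (i + 1) * σ (superlevel t σ g L (2 ^ (i + 1))) :=
        ((Equiv.addRight (1 : ℤ)).tsum_eq
          fun i => (4 : ℝ≥0∞) ^ i * σ (superlevel t σ g L (2 ^ i))).symm
    _ ≤ ∑' i : ℤ, ∫⁻ x, 4 * (g x * (if (2 : ℝ≥0∞) ^ i < g x then (2 : ℝ≥0∞) ^ i else 0)) ∂σ := by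
        refine ENNReal.tsum_le_tsum fun i => ?_
        have hi : (2 : ℝ≥0∞) ^ i ≠ ⊤ := ENNReal.zpow_ne_top two0 twoT i
        have h := mul_measure_superlevel_le t σ hg L hi
        have e2 : (2 : ℝ≥0∞) ^ (i + 1) = 2 * 2 ^ i := by
          rw [ENNReal.zpow_add two0 twoT, zpow_one, mul_comm]
        have e4 : (4 : ℝ≥0∞) ^ (i + 1) = 4 * 2 ^ i * 2 ^ i := by
          rw [ENNReal.zpow_add (by norm_num) (by norm_num), zpow_one,
            four_zpow, mul_comm, mul_assoc]
        rw [e2, e4, mul_assoc]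
        calc _ ≤ 4 * 2 ^ i * ∫⁻ x in {x | (2 : ℝ≥0∞) ^ i < g x}, g x ∂σ := by gcongr
          _ = _ := by
            rw [← lintegral_const_mul _ hg,
              ← lintegral_indicator (measurableSet_lt measurable_const hg)]
            refine lintegral_congr fun x => ?_
            by_cases hx : (2 : ℝ≥0∞) ^ i < g x
            · simp only [Set.indicator, Set.mem_ofPred_eq, hx, if_true]; ring
            · simp [Set.indicator, hx]
    _ = ∫⁻ x, ∑' i : ℤ, 4 * (g x * (if (2 : ℝ≥0∞) ^ i < g x then (2 : ℝ≥0∞) ^ i else 0)) ∂σ := by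
        refine (lintegral_tsum fun i => Measurable.aemeasurable ?_).symm
        exact (hg.mul (Measurable.ite (measurableSet_lt measurable_const hg) measurable_const
          measurable_const)).const_mul 4
    _ ≤ ∫⁻ x, 8 * g x ^ 2 ∂σ := by
        refine lintegral_mono fun x => ?_
        simp only [ENNReal.tsum_mul_left]
        calc _ ≤ 4 * (g x * (2 * g x)) := by gcongr; exact tsum_two_zpow_lt_le _
          _ = _ := by ring
    _ = _ := lintegral_const_mul _ (hg.pow_const 2)

/-! ### Whitney cells and the testing condition -/

/-- `l` is the largest scale at most `L` such that the ball of radius `2 ^ (l + α)` around `x` lies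
in `U`. The cells of scale `l` around such `x` form a Whitney type covering of `U`; the cap `L`
makes it available even if `U` is the whole space. -/
def IsWhitneyScale {n : ℕ} (U : Set (Fin n → ℝ)) (α : ℕ) (L : ℤ) (x : Fin n → ℝ) (l : ℤ) : Prop :=
  l ≤ L ∧ Metric.ball x (2 ^ (l + α)) ⊆ U ∧ ∀ k ≤ L, Metric.ball x (2 ^ (k + α)) ⊆ U → k ≤ l

lemma IsWhitneyScale.unique {n : ℕ} {U : Set (Fin n → ℝ)} {α : ℕ} {L : ℤ} {x : Fin n → ℝ}
    {l l' : ℤ} (h : IsWhitneyScale U α L x l) (h' : IsWhitneyScale U α L x l') : l = l' :=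
  le_antisymm (h'.2.2 l h.1 h.2.1) (h.2.2 l' h'.1 h'.2.1)

lemma exists_isWhitneyScale {n : ℕ} {U : Set (Fin n → ℝ)} {α : ℕ} {L : ℤ} {x : Fin n → ℝ}
    {k : ℤ} (hk : k ≤ L) (h : Metric.ball x (2 ^ (k + α)) ⊆ U) :
    ∃ l, k ≤ l ∧ IsWhitneyScale U α L x l := by
  obtain ⟨l, hl, hmax⟩ := Int.exists_greatest_of_bdd
    (P := fun l => l ≤ L ∧ Metric.ball x (2 ^ (l + α)) ⊆ U) ⟨L, fun z hz => hz.1⟩ ⟨k, hk, h⟩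
  exact ⟨l, hmax k ⟨hk, h⟩, hl.1, hl.2, fun l' h1 h2 => hmax l' ⟨h1, h2⟩⟩

lemma measurableSet_ball_subset {n : ℕ} (U : Set (Fin n → ℝ)) (r : ℝ) :
    MeasurableSet {x | Metric.ball x r ⊆ U} := by
  have : {x | Metric.ball x r ⊆ U} = (Metric.thickening r Uᶜ)ᶜ := by
    ext x
    simp only [Set.mem_ofPred_eq, Set.mem_compl_iff, Metric.mem_thickening_iff, not_exists, not_and,
      Set.subset_def, Metric.mem_ball]
    refine forall_congr' fun y => ?_
    rw [dist_comm]
    tauto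
  rw [this]
  exact Metric.isOpen_thickening.measurableSet.compl

lemma measurableSet_isWhitneyScale {n : ℕ} (U : Set (Fin n → ℝ)) (α : ℕ) (L l : ℤ) :
    MeasurableSet {x | IsWhitneyScale U α L x l} := by
  have : {x | IsWhitneyScale U α L x l} = {_x | l ≤ L} ∩ ({x | Metric.ball x (2 ^ (l + α)) ⊆ U} ∩
      ⋂ k : ℤ, ({_x | ¬ k ≤ L} ∪ ({x | Metric.ball x (2 ^ (k + α)) ⊆ U}ᶜ ∪ {_x | k ≤ l}))) := by
    ext x
    simp only [IsWhitneyScale, Set.mem_ofPred_eq, Set.mem_inter_iff, Set.mem_iInter, Set.mem_union,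
      Set.mem_compl_iff, imp_iff_not_or]
  rw [this]
  exact (MeasurableSet.const _).inter ((measurableSet_ball_subset _ _).inter
    (MeasurableSet.iInter fun k => (MeasurableSet.const _).union
      ((measurableSet_ball_subset _ _).compl.union (MeasurableSet.const _))))

/-- A point of the dilated Whitney cell of `x` is so close to `x`, compared with the distance to the
complement of `U`, that its own Whitney scale differs by at most one. -/
lemma IsWhitneyScale.of_mem_dilate {n : ℕ} {U : Set (Fin n → ℝ)} {α : ℕ} {L l : ℤ}
    {t : Fin n → Fin 3} {x y : Fin n → ℝ} {Γ : ℝ} (hΓ : 1 ≤ Γ) (hα : 2 * Γ ≤ 2 ^ α)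
    (hx : IsWhitneyScale U α L x l) (hy : y ∈ (cellAt t l x).dilate Γ) :
    y ∈ U ∧ ∃ l', IsWhitneyScale U α L y l' ∧ l' - 1 ≤ l ∧ l ≤ l' + 1 := by
  have pos : (0 : ℝ) < 2 ^ l := by positivity
  have e : ∀ k : ℤ, (2 : ℝ) ^ (k + α) = 2 ^ k * 2 ^ α := fun k => by
    rw [zpow_add₀ (by norm_num), zpow_natCast]
  have hd : dist y x ≤ Γ * 2 ^ l := by
    rw [dist_pi_le_iff (by positivity)]
    intro i
    have h1 := (mem_box.1 hy) i
    have h2 := (mem_box.1 (self_mem_cellAt t l x)) i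
    have h3 : (cellAt t l x).side = 2 ^ l := rfl
    rw [h3] at h1 h2
    rw [Real.dist_eq, abs_le]
    constructor <;> nlinarith
  have hd2 : dist y x ≤ 2 ^ (l + α) / 2 := by
    rw [e]; nlinarith
  have pos2 : (0 : ℝ) < 2 ^ (l + α) := by positivity
  have down : Metric.ball y (2 ^ (l - 1 + α)) ⊆ U := by
    refine (Metric.ball_subset_ball' ?_).trans hx.2.1
    have : (2 : ℝ) ^ (l - 1 + α) = 2 ^ (l + α) / 2 := by
      rw [show l - 1 + α = l + α - 1 by ring, zpow_sub_one₀ (by norm_num)]; ring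
    linarith
  refine ⟨hx.2.1 (by rw [Metric.mem_ball]; linarith), ?_⟩
  obtain ⟨l', h1, h2⟩ := exists_isWhitneyScale (L := L) (by linarith [hx.1]) down
  refine ⟨l', h2, ?_, by omega⟩
  by_contra hcon
  have hl' : l + 2 ≤ l' := by omega
  have up : Metric.ball x (2 ^ (l + 1 + α)) ⊆ U := by
    refine (Metric.ball_subset_ball' ?_).trans h2.2.1
    have h3 : (2 : ℝ) ^ (l + 1 + α) = 2 ^ (l + α) * 2 := by
      rw [show l + 1 + α = l + α + 1 by ring, zpow_add_one₀ (by norm_num)]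
    have h4 : (2 : ℝ) ^ (l + α) * 4 ≤ 2 ^ (l' + α) := by
      calc (2 : ℝ) ^ (l + α) * 4 = 2 ^ (l + α + 2) := by
            rw [zpow_add₀ (by norm_num) (l + α : ℤ) 2]; norm_num
        _ ≤ _ := zpow_le_zpow_right₀ (by norm_num) (by omega)
    rw [dist_comm]
    linarith
  have := hx.2.2 (l + 1) (by linarith [h2.1]) up
  omega

lemma abs_gridIndex_sub_le_of_mem_dilate {n : ℕ} {t : Fin n → Fin 3} {k : ℤ} {j : Fin n → ℤ}
    {y : Fin n → ℝ} {Γ : ℝ} {R : ℕ} (hR : Γ ≤ R) (hy : y ∈ (gridCell t k j).dilate Γ)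
    (i : Fin n) : |j i - gridIndex t k y i| ≤ R + 1 := by
  have pos : (0 : ℝ) < 2 ^ k := by positivity
  have h1 := (mem_box.1 hy) i
  have h3 : (gridCell t k j).side = 2 ^ k := rfl
  rw [h3] at h1
  have h2 := sub_center_gridCell t k j y i
  have h4 : gridCoord t k y i - j i - 1 / 2 ≤ Γ / 2 := by nlinarith
  have h5 : -(Γ / 2) ≤ gridCoord t k y i - j i - 1 / 2 := by nlinarith
  have h6 := Int.floor_le (gridCoord t k y i)
  have h7 := Int.lt_floor_add_one (gridCoord t k y i)
  have h8 : (0 : ℝ) ≤ R := by positivity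
  have h9 : |(j i : ℝ) - gridIndex t k y i| ≤ R + 1 := by
    rw [gridIndex, abs_le]
    constructor <;> linarith
  exact_mod_cast h9

/-- The dilates of the Whitney cells overlap boundedly. -/
lemma exists_finset_whitneyCell {n : ℕ} (U : Set (Fin n → ℝ)) {α : ℕ} (L : ℤ)
    (t : Fin n → Fin 3) {Γ : ℝ} (hΓ : 1 ≤ Γ) (hα : 2 * Γ ≤ 2 ^ α) {R : ℕ} (hR : Γ ≤ R)
    (y : Fin n → ℝ) :
    ∃ F : Finset (ℤ × (Fin n → ℤ)), F.card ≤ 3 * (2 * R + 3) ^ n ∧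
      ∀ l x, IsWhitneyScale U α L x l → y ∈ (cellAt t l x).dilate Γ →
        (l, gridIndex t l x) ∈ F := by
  by_cases hy : ∃ l', IsWhitneyScale U α L y l'
  · obtain ⟨l', hl'⟩ := hy
    refine ⟨(Finset.Icc (l' - 1) (l' + 1)).biUnion fun l => (Fintype.piFinset fun i =>
      Finset.Icc (gridIndex t l y i - (R + 1)) (gridIndex t l y i + (R + 1))).image
        (Prod.mk l), ?_, ?_⟩
    · refine (Finset.card_biUnion_le_card_mul _ _ ((2 * R + 3) ^ n) fun l _ => ?_).trans ?_
      · refine Finset.card_image_le.trans ?_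
        rw [Fintype.card_piFinset]
        refine (Finset.prod_le_pow_card _ _ (2 * R + 3) fun i _ => ?_).trans (by simp)
        rw [Int.card_Icc]
        omega
      · gcongr
        rw [Int.card_Icc]
        omega
    · intro l x hx hyx
      obtain ⟨-, l'', h1, h2, h3⟩ := hx.of_mem_dilate hΓ hα hyx
      have : l'' = l' := h1.unique hl'
      subst this
      refine Finset.mem_biUnion.2 ⟨l, Finset.mem_Icc.2 ⟨h2, h3⟩,
        Finset.mem_image.2 ⟨_, Fintype.mem_piFinset.2 fun i => ?_, rfl⟩⟩
      have := abs_le.1 (abs_gridIndex_sub_le_of_mem_dilate hR hyx i)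
      rw [Finset.mem_Icc]
      constructor <;> linarith [this.1, this.2]
  · refine ⟨∅, by simp, fun l x hx hyx => ?_⟩
    obtain ⟨-, l'', h1, -⟩ := hx.of_mem_dilate hΓ hα hyx
    exact absurd ⟨l'', h1⟩ hy

/-- The testing condition on the Whitney cells of `U` controls, by bounded overlap of their dilates,
any function that is dominated on each of them by the maximal function of the restriction of `σ`. -/
lemma lintegral_le_of_isWhitneyScale {n : ℕ} {σ ω : Measure (Fin n → ℝ)}
    {U : Set (Fin n → ℝ)} (mU : MeasurableSet U) {α : ℕ} (L : ℤ) (t : Fin n → Fin 3) {Γ : ℝ}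
    (hΓ : 1 ≤ Γ) (hα : 2 * Γ ≤ 2 ^ α) {R : ℕ} (hR : Γ ≤ R) {T : ℝ≥0∞}
    (hT : ∀ Q : Cube n,
      ∫⁻ x in Q.toSet, maximal (σ.restrict Q.toSet) x ^ 2 ∂ω ≤ T ^ 2 * σ (Q.dilate Γ))
    {h : (Fin n → ℝ) → ℝ≥0∞}
    (hh : ∀ x, h x ≠ 0 → ∃ l, IsWhitneyScale U α L x l ∧
      h x ≤ maximal (σ.restrict (cellAt t l x).toSet) x ^ 2) :
    ∫⁻ x, h x ∂ω ≤ (3 * (2 * R + 3) ^ n : ℕ) * (T ^ 2 * σ U) := by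
  classical
  set A : ℤ × (Fin n → ℤ) → Set (Fin n → ℝ) := fun p =>
    {x | IsWhitneyScale U α L x p.1} ∩ (gridCell t p.1 p.2).toSet with hA
  set B : ℤ × (Fin n → ℤ) → Set (Fin n → ℝ) := fun p =>
    if (A p).Nonempty then (gridCell t p.1 p.2).dilate Γ else ∅ with hB
  have mA : ∀ p, MeasurableSet (A p) := fun p =>
    (measurableSet_isWhitneyScale U α L p.1).inter (gridCell t p.1 p.2).measurableSet_toSet
  have mB : ∀ p, MeasurableSet (B p) := by
    intro p
    simp only [hB]
    split_ifs
    · exact measurableSet_box _ _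
    · exact MeasurableSet.empty
  have memB : ∀ p y, y ∈ B p → ∃ x, IsWhitneyScale U α L x p.1 ∧ gridIndex t p.1 x = p.2 ∧
      y ∈ (cellAt t p.1 x).dilate Γ := by
    intro p y hy
    simp only [hB] at hy
    split_ifs at hy with hne
    · obtain ⟨x, hx1, hx2⟩ := hne
      have hx3 := mem_gridCell.1 hx2
      exact ⟨x, hx1, hx3, by rw [cellAt, hx3]; exact hy⟩
    · exact hy.elim
  have hpart : ∀ p, ∫⁻ x in A p, h x ∂ω ≤ T ^ 2 * σ (B p) := by
    intro p
    by_cases hne : (A p).Nonempty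
    · have : B p = (gridCell t p.1 p.2).dilate Γ := if_pos hne
      rw [this]
      refine le_trans ?_ (hT (gridCell t p.1 p.2))
      refine le_trans (setLIntegral_mono' (mA p) fun x hx => ?_)
        (lintegral_mono_set Set.inter_subset_right)
      by_cases h0 : h x = 0
      · rw [h0]; exact zero_le
      obtain ⟨l, hl, hle⟩ := hh x h0
      have e : l = p.1 := hl.unique hx.1
      subst e
      rwa [cellAt, mem_gridCell.1 hx.2] at hle
    · rw [Set.not_nonempty_iff_eq_empty.1 hne]
      simp
  have hsupp : ∀ x, h x ≤ (⋃ p, A p).indicator h x := by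
    intro x
    by_cases h0 : h x = 0
    · rw [h0]; exact zero_le
    obtain ⟨l, hl, -⟩ := hh x h0
    have : x ∈ ⋃ p, A p :=
      Set.mem_iUnion.2 ⟨(l, gridIndex t l x), hl, self_mem_cellAt t l x⟩
    rw [Set.indicator_of_mem this]
  have hover : ∀ y, ∑' p, (B p).indicator (fun _ => (1 : ℝ≥0∞)) y
      ≤ U.indicator (fun _ => ((3 * (2 * R + 3) ^ n : ℕ) : ℝ≥0∞)) y := by
    intro y
    by_cases hyU : y ∈ U
    · rw [Set.indicator_of_mem hyU]
      obtain ⟨F, hF, hmem⟩ := exists_finset_whitneyCell U L t hΓ hα hR y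
      have hz : ∀ p ∉ F, (B p).indicator (fun _ => (1 : ℝ≥0∞)) y = 0 := by
        intro p hp
        refine Set.indicator_of_notMem (fun hy => hp ?_) _
        obtain ⟨x, h1, h2, h3⟩ := memB p y hy
        have := hmem p.1 x h1 h3
        rwa [h2] at this
      rw [tsum_eq_sum hz]
      calc _ ≤ ∑ _p ∈ F, (1 : ℝ≥0∞) :=
            Finset.sum_le_sum fun p _ => Set.indicator_le_self' (fun _ _ => zero_le) y
        _ = (F.card : ℝ≥0∞) := by simp
        _ ≤ _ := by exact_mod_cast hF
    · rw [Set.indicator_of_notMem hyU]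
      refine le_of_eq (ENNReal.tsum_eq_zero.2 fun p => Set.indicator_of_notMem (fun hy => ?_) _)
      obtain ⟨x, h1, -, h3⟩ := memB p y hy
      exact hyU (h1.of_mem_dilate hΓ hα h3).1
  calc ∫⁻ x, h x ∂ω ≤ ∫⁻ x, (⋃ p, A p).indicator h x ∂ω := lintegral_mono hsupp
    _ = ∫⁻ x in ⋃ p, A p, h x ∂ω := lintegral_indicator (MeasurableSet.iUnion mA) _
    _ ≤ ∑' p, ∫⁻ x in A p, h x ∂ω := lintegral_iUnion_le _ _
    _ ≤ ∑' p, T ^ 2 * σ (B p) := ENNReal.tsum_le_tsum hpart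
    _ = T ^ 2 * ∑' p, ∫⁻ y, (B p).indicator (fun _ => (1 : ℝ≥0∞)) y ∂σ := by
        rw [ENNReal.tsum_mul_left]
        congr 2
        funext p
        simp [lintegral_indicator (mB p)]
    _ = T ^ 2 * ∫⁻ y, ∑' p, (B p).indicator (fun _ => (1 : ℝ≥0∞)) y ∂σ := by
        rw [lintegral_tsum fun p => (measurable_const.indicator (mB p)).aemeasurable]
    _ ≤ T ^ 2 * ∫⁻ y, U.indicator (fun _ => ((3 * (2 * R + 3) ^ n : ℕ) : ℝ≥0∞)) y ∂σ := by
        gcongr with y; exact hover y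
    _ = _ := by
        rw [lintegral_indicator mU, setLIntegral_const]; ring

/-! ### Domination of the maximal function -/

/-- The squared density of `σ` on the cells of scale at most `L` around `x` whose ancestor of scale
`k + m` is deep around `x` and carries an average of at least `a`; the supremum over the scales. -/
def deepDensity {n : ℕ} (t : Fin n → Fin 3) (σ : Measure (Fin n → ℝ)) (g : (Fin n → ℝ) → ℝ≥0∞)
    (m : ℕ) (L : ℤ) (a : ℝ≥0∞) (x : Fin n → ℝ) : ℝ≥0∞ :=
  ⨆ k : ℤ, ({x | k ≤ L ∧ IsDeep t (k + m) x ∧ a ≤ gridAverage t σ g (k + m) x}).indicator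
    (fun x => cubeAverage σ (cellAt t k x) ^ 2) x

lemma measurable_deepDensity {n : ℕ} (t : Fin n → Fin 3) (σ : Measure (Fin n → ℝ))
    (g : (Fin n → ℝ) → ℝ≥0∞) (m : ℕ) (L : ℤ) (a : ℝ≥0∞) :
    Measurable (deepDensity t σ g m L a) := by
  refine Measurable.iSup fun k => Measurable.indicator ?_ ?_
  · exact measurable_of_gridIndex (t := t) (k := k) fun x y h => by simp only [cellAt_congr h]
  · exact (MeasurableSet.const _).inter ((measurableSet_isDeep t _).inter
      (measurableSet_le measurable_const (measurable_gridAverage t σ g _)))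

lemma deepDensity_mono {n : ℕ} (t : Fin n → Fin 3) (σ : Measure (Fin n → ℝ))
    (g : (Fin n → ℝ) → ℝ≥0∞) (m : ℕ) (a : ℝ≥0∞) {L L' : ℤ} (h : L ≤ L') (x : Fin n → ℝ) :
    deepDensity t σ g m L a x ≤ deepDensity t σ g m L' a x := by
  refine iSup_mono fun k => ?_
  refine Set.indicator_le_indicator_of_subset ?_ (fun _ => zero_le) x
  exact fun y hy => ⟨hy.1.trans h, hy.2⟩

/-- The cells counted by `deepDensity` lie inside the Whitney cell around `x` of the superlevel
set. -/
lemma lintegral_deepDensity_le {n : ℕ} {σ ω : Measure (Fin n → ℝ)} (g : (Fin n → ℝ) → ℝ≥0∞)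
    {α : ℕ} (L : ℤ) (t : Fin n → Fin 3) {Γ : ℝ}
    (hΓ : 1 ≤ Γ) (hα : 2 * Γ ≤ 2 ^ α) {R : ℕ} (hR : Γ ≤ R) {T : ℝ≥0∞}
    (hT : ∀ Q : Cube n,
      ∫⁻ x in Q.toSet, maximal (σ.restrict Q.toSet) x ^ 2 ∂ω ≤ T ^ 2 * σ (Q.dilate Γ))
    (a : ℝ≥0∞) :
    ∫⁻ x, deepDensity t σ g (α + 3) L a x ∂ω
      ≤ (3 * (2 * R + 3) ^ n : ℕ) * (T ^ 2 * σ (superlevel t σ g (L + (α + 3 : ℕ)) a)) := by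
  set U := superlevel t σ g (L + (α + 3 : ℕ)) a with hU
  have sub : ∀ x k, k ≤ L → IsDeep t (k + (α + 3 : ℕ)) x →
      a ≤ gridAverage t σ g (k + (α + 3 : ℕ)) x → Metric.ball x (2 ^ (k + α)) ⊆ U := by
    intro x k hk hd ha y hy
    refine ⟨k + (α + 3 : ℕ), by linarith, ?_⟩
    rw [gridAverage_congr (hd.gridIndex_eq fun i => ?_)]
    · exact ha
    · have e : (2 : ℝ) ^ (k + (α + 3 : ℕ)) = 2 ^ (k + α) * 8 := by
        push_cast
        rw [← add_assoc, zpow_add₀ (by norm_num)]; norm_num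
      rw [e, mul_div_cancel_right₀ _ (by norm_num), ← Real.dist_eq]
      exact (dist_le_pi_dist y x i).trans_lt hy
  refine lintegral_le_of_isWhitneyScale (measurableSet_superlevel t σ g _ a) L t hΓ hα hR hT
    fun x hx => ?_
  obtain ⟨l, hl⟩ : ∃ l, IsWhitneyScale U α L x l := by
    by_contra hcon
    refine hx (le_antisymm (iSup_le fun k => ?_) (zero_le))
    rw [Set.indicator_of_notMem]
    rintro ⟨h1, h2, h3⟩
    obtain ⟨l, -, hl⟩ := exists_isWhitneyScale h1 (sub x k h1 h2 h3)
    exact hcon ⟨l, hl⟩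
  refine ⟨l, hl, iSup_le fun k => ?_⟩
  by_cases hk : x ∈ {x | k ≤ L ∧ IsDeep t (k + (α + 3 : ℕ)) x ∧
      a ≤ gridAverage t σ g (k + (α + 3 : ℕ)) x}
  · rw [Set.indicator_of_mem hk]
    have hkl : k ≤ l := hl.2.2 k hk.1 (sub x k hk.1 hk.2.1 hk.2.2)
    have hss : (cellAt t k x).toSet ⊆ (cellAt t l x).toSet := fun y hy =>
      mem_cellAt.2 (gridIndex_congr_of_le hkl (mem_cellAt.1 hy))
    gcongr
    refine le_trans (le_of_eq ?_) (cubeAverage_le_maximal _ (self_mem_cellAt t k x))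
    rw [cubeAverage, cubeAverage, Measure.restrict_apply (cellAt t k x).measurableSet_toSet,
      Set.inter_eq_left.2 hss]
  · rw [Set.indicator_of_notMem hk]
    exact zero_le

/-- The sum of `deepDensity` over dyadic thresholds, weighted by their squares. -/
def deepSum {n : ℕ} (t : Fin n → Fin 3) (σ : Measure (Fin n → ℝ)) (g : (Fin n → ℝ) → ℝ≥0∞)
    (m : ℕ) (L : ℤ) (x : Fin n → ℝ) : ℝ≥0∞ :=
  ∑' i : ℤ, 4 ^ i * deepDensity t σ g m L (2 ^ i) x

lemma measurable_deepSum {n : ℕ} (t : Fin n → Fin 3) (σ : Measure (Fin n → ℝ))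
    (g : (Fin n → ℝ) → ℝ≥0∞) (m : ℕ) (L : ℤ) : Measurable (deepSum t σ g m L) :=
  Measurable.tsum fun _ => (measurable_deepDensity t σ g m L _).const_mul _

lemma lintegral_iSup_deepSum_le {n : ℕ} {σ ω : Measure (Fin n → ℝ)} [IsLocallyFiniteMeasure σ]
    {g : (Fin n → ℝ) → ℝ≥0∞} (hg : Measurable g)
    {α : ℕ} (t : Fin n → Fin 3) {Γ : ℝ}
    (hΓ : 1 ≤ Γ) (hα : 2 * Γ ≤ 2 ^ α) {R : ℕ} (hR : Γ ≤ R) {T : ℝ≥0∞}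
    (hT : ∀ Q : Cube n,
      ∫⁻ x in Q.toSet, maximal (σ.restrict Q.toSet) x ^ 2 ∂ω ≤ T ^ 2 * σ (Q.dilate Γ)) :
    ∫⁻ x, ⨆ L : ℕ, deepSum t σ g (α + 3) L x ∂ω
      ≤ (3 * (2 * R + 3) ^ n : ℕ) * (T ^ 2 * (8 * ∫⁻ x, g x ^ 2 ∂σ)) := by
  rw [lintegral_iSup (fun L => measurable_deepSum t σ g _ _)]
  · refine iSup_le fun L => ?_
    simp only [deepSum]
    rw [lintegral_tsum fun i => ((measurable_deepDensity t σ g _ _ _).const_mul _).aemeasurable]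
    calc _ ≤ ∑' i : ℤ, (3 * (2 * R + 3) ^ n : ℕ) * (T ^ 2 *
            (4 ^ i * σ (superlevel t σ g (L + (α + 3 : ℕ)) (2 ^ i)))) := by
          refine ENNReal.tsum_le_tsum fun i => ?_
          rw [lintegral_const_mul _ (measurable_deepDensity t σ g _ _ _)]
          refine (mul_le_mul_right
            (lintegral_deepDensity_le g L t hΓ hα hR hT (2 ^ i)) _).trans (le_of_eq ?_)
          ring
      _ ≤ _ := by
          rw [ENNReal.tsum_mul_left, ENNReal.tsum_mul_left]
          gcongr
          exact tsum_four_zpow_mul_measure_superlevel_le t σ hg _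
  · intro L L' hLL' x
    exact ENNReal.tsum_le_tsum fun i =>
      mul_le_mul_right (deepDensity_mono t σ g _ _ (by exact_mod_cast hLL') x) _

/-- The sum over the scales of the jumps of the averages, weighted by the squared density of `σ` on
the cells. -/
def jumpSum {n : ℕ} (t : Fin n → Fin 3) (σ : Measure (Fin n → ℝ)) (g : (Fin n → ℝ) → ℝ≥0∞)
    (m : ℕ) (x : Fin n → ℝ) : ℝ≥0∞ :=
  ∑' k : ℤ, jump t σ g m k x * cubeAverage σ (cellAt t k x) ^ 2

lemma measurable_jump_mul {n : ℕ} (t : Fin n → Fin 3) (σ : Measure (Fin n → ℝ))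
    (g : (Fin n → ℝ) → ℝ≥0∞) (m : ℕ) (k : ℤ) :
    Measurable fun x => jump t σ g m k x * cubeAverage σ (cellAt t k x) ^ 2 :=
  measurable_of_gridIndex (t := t) (k := k) fun _ _ h => by rw [jump_congr h, cellAt_congr h]

lemma lintegral_jumpSum_le {n : ℕ} (t : Fin n → Fin 3) (σ ω : Measure (Fin n → ℝ))
    [IsLocallyFiniteMeasure σ] {g : (Fin n → ℝ) → ℝ≥0∞} (hg : Measurable g)
    (hg2 : ∫⁻ x, g x ^ 2 ∂σ ≠ ⊤) (m : ℕ) [NeZero m] :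
    ∫⁻ x, jumpSum t σ g m x ∂ω ≤ muckenhouptA2 σ ω * (m * (4 * ∫⁻ x, g x ^ 2 ∂σ)) := by
  simp only [jumpSum]
  rw [lintegral_tsum fun k => (measurable_jump_mul t σ g m k).aemeasurable]
  calc _ ≤ ∑' k, muckenhouptA2 σ ω * ∫⁻ x, jump t σ g m k x ∂σ :=
        ENNReal.tsum_le_tsum fun k =>
          lintegral_mul_cubeAverage_sq_le fun _ _ h => jump_congr h
    _ ≤ _ := by
        rw [ENNReal.tsum_mul_left]
        gcongr
        exact tsum_lintegral_jump_le t σ hg hg2 m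

lemma gridAverage_ne_top {n : ℕ} (t : Fin n → Fin 3) (σ : Measure (Fin n → ℝ))
    [IsLocallyFiniteMeasure σ] {g : (Fin n → ℝ) → ℝ≥0∞}
    (hg2 : ∫⁻ x, g x ^ 2 ∂σ ≠ ⊤) (k : ℤ) (x : Fin n → ℝ) : gridAverage t σ g k x ≠ ⊤ := by
  set Q := (cellAt t k x).toSet
  intro htop
  have hi : gridAverage t σ g k x * σ Q = ∫⁻ y in Q, g y ∂σ := gridAverage_mul_measure t σ g k x
  have hfin : ∫⁻ y in Q, g y ∂σ ≠ ⊤ := by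
    have hle : ∫⁻ y in Q, g y ∂σ ≤ σ Q + ∫⁻ y, g y ^ 2 ∂σ := by
      calc ∫⁻ y in Q, g y ∂σ ≤ ∫⁻ y in Q, (1 + g y ^ 2) ∂σ := by
            refine lintegral_mono fun y => ?_
            rcases le_total (g y) 1 with h | h
            · exact h.trans le_self_add
            · exact (le_self_pow h two_ne_zero).trans le_add_self
        _ = σ Q + ∫⁻ y in Q, g y ^ 2 ∂σ := by
            rw [lintegral_add_left measurable_const]; simp
        _ ≤ _ := by gcongr; exact Measure.restrict_le_self
    exact ne_top_of_le_ne_top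
      (ENNReal.add_ne_top.2 ⟨(cellAt t k x).measure_toSet_ne_top σ, hg2⟩) hle
  rw [gridAverage, ENNReal.div_eq_top] at htop
  rcases htop with ⟨h1, h2⟩ | ⟨h1, -⟩
  · exact h1 (setLIntegral_measure_zero _ _ h2)
  · exact hfin h1

/-- A cube `P ∋ x` lies in a comparable cell of some grid such that `x` is deep in the ancestor of
this cell `m` scales above. Either the average of `g` jumps between the two cells, or the average
over the ancestor controls the average over `P`. -/
lemma cubeAverage_withDensity_sq_le {n : ℕ} {σ : Measure (Fin n → ℝ)} [IsLocallyFiniteMeasure σ]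
    {g : (Fin n → ℝ) → ℝ≥0∞} (hg2 : ∫⁻ x, g x ^ 2 ∂σ ≠ ⊤) (m : ℕ)
    {P : Cube n} {x : Fin n → ℝ} (hx : x ∈ P.toSet) :
    ∃ t : Fin n → Fin 3, cubeAverage (σ.withDensity g) P ^ 2
      ≤ 64 ^ n * (jumpSum t σ g m x + 16 * ⨆ L : ℕ, deepSum t σ g m L x) := by
  -- Three scales above `P`, an eighth of the side length of a cell is the side length of `P`.
  set k := P.scale + 3 with hk
  obtain ⟨t, h1, h2⟩ := exists_isDeep_isDeep k (k + m) x
  refine ⟨t, ?_⟩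
  set e := gridAverage t σ g k x with he
  set e' := gridAverage t σ g (k + m) x with he'
  set a := cubeAverage σ (cellAt t k x) with ha
  have e8 : (2 : ℝ) ^ k = 2 ^ P.scale * 8 := by
    rw [hk, zpow_add₀ (by norm_num)]; norm_num
  have hsub : P.toSet ⊆ (cellAt t k x).toSet := by
    intro y hy
    refine mem_cellAt.2 (h1.gridIndex_eq fun i => ?_)
    have hx' := (mem_box.1 hx) i
    have hy' := (mem_box.1 hy) i
    have hs : P.side = 2 ^ P.scale := rfl
    rw [hs] at hx' hy'
    rw [e8, mul_div_cancel_right₀ _ (by norm_num), abs_lt]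
    constructor <;> linarith [hx'.1, hx'.2, hy'.1, hy'.2]
  have hvol : volume (cellAt t k x).toSet = 8 ^ n * volume P.toSet := by
    rw [Cube.volume_toSet, Cube.volume_toSet]
    have : (2 : ℝ) ^ (cellAt t k x).scale = 8 * 2 ^ P.scale := e8.trans (mul_comm _ _)
    rw [this, ENNReal.ofReal_mul (by norm_num), mul_pow]
    norm_num
  have hP : cubeAverage (σ.withDensity g) P ≤ 8 ^ n * (e * a) := by
    have h8 : (8 : ℝ≥0∞) ^ n ≠ 0 := by positivity
    have h8' : (8 : ℝ≥0∞) ^ n ≠ ⊤ := ENNReal.pow_ne_top (by norm_num)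
    have hn : σ.withDensity g P.toSet ≤ e * σ (cellAt t k x).toSet := by
      rw [he, gridAverage_mul_measure, withDensity_apply _ P.measurableSet_toSet]
      exact lintegral_mono_set hsub
    calc cubeAverage (σ.withDensity g) P
        ≤ e * σ (cellAt t k x).toSet / volume P.toSet := by
          rw [cubeAverage]; gcongr
      _ = 8 ^ n * (e * a) := by
          rw [ha, cubeAverage, hvol, div_eq_mul_inv, div_eq_mul_inv,
            ENNReal.mul_inv (Or.inl h8) (Or.inl h8')]
          calc e * σ (cellAt t k x).toSet * (volume P.toSet)⁻¹
              = (8 ^ n * (8 ^ n)⁻¹) * (e * σ (cellAt t k x).toSet * (volume P.toSet)⁻¹) := by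
                rw [ENNReal.mul_inv_cancel h8 h8', one_mul]
            _ = _ := by ring
  calc cubeAverage (σ.withDensity g) P ^ 2 ≤ (8 ^ n * (e * a)) ^ 2 := by gcongr
    _ = 64 ^ n * (e ^ 2 * a ^ 2) := by
        rw [mul_pow, ← pow_mul, mul_comm n 2, pow_mul, mul_pow]; norm_num
    _ ≤ _ := by
        gcongr
        by_cases hj : 2 * e' ≤ e
        · refine le_trans ?_ le_self_add
          have : jump t σ g m k x = e ^ 2 := by
            rw [jump, Set.indicator_of_mem]
            exact hj
          rw [← this]
          exact ENNReal.le_tsum (f := fun k =>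
            jump t σ g m k x * cubeAverage σ (cellAt t k x) ^ 2) k
        · refine le_trans ?_ le_add_self
          push Not at hj
          have h0 : e' ≠ 0 := by
            rintro h
            rw [h] at hj
            simp at hj
          -- The truncation level only has to exceed the scale `k`.
          obtain ⟨i, hi1, hi2⟩ := ENNReal.exists_mem_Ico_zpow h0
            (gridAverage_ne_top t σ hg2 (k + m) x) (y := 2) (by norm_num) (by norm_num)
          have hdd : a ^ 2 ≤ deepDensity t σ g m k.toNat (2 ^ i) x := by
            refine le_trans (le_of_eq ?_) (le_iSup _ k)
            rw [Set.indicator_of_mem]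
            exact ⟨Int.self_le_toNat k, h2, hi1⟩
          have hds : 4 ^ i * deepDensity t σ g m k.toNat (2 ^ i) x ≤
              ⨆ L : ℕ, deepSum t σ g m L x :=
            (ENNReal.le_tsum (f := fun i : ℤ => 4 ^ i * deepDensity t σ g m k.toNat (2 ^ i) x)
              i).trans (le_iSup (fun L : ℕ => deepSum t σ g m L x) k.toNat)
          calc e ^ 2 * a ^ 2 ≤ (2 * (2 * 2 ^ i)) ^ 2 * a ^ 2 := by
                gcongr
                refine hj.le.trans ?_
                gcongr
                rw [← two_zpow_add_one]
                exact hi2.le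
            _ = 16 * (4 ^ i * a ^ 2) := by rw [four_zpow]; ring
            _ ≤ 16 * (4 ^ i * deepDensity t σ g m k.toNat (2 ^ i) x) := by gcongr
            _ ≤ _ := by gcongr

/-! ### The two inequalities -/

lemma sq_rpow_half (a : ℝ≥0∞) : (a ^ 2) ^ (1 / 2 : ℝ) = a := by
  rw [← ENNReal.rpow_two, ← ENNReal.rpow_mul]; norm_num

lemma rpow_half_sq (a : ℝ≥0∞) : (a ^ (1 / 2 : ℝ)) ^ 2 = a := by
  rw [← ENNReal.rpow_two, ← ENNReal.rpow_mul]; norm_num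

lemma le_rpow_half_of_sq_le {a b : ℝ≥0∞} (h : a ^ 2 ≤ b) : a ≤ b ^ (1 / 2 : ℝ) := by
  rw [← sq_rpow_half a]
  exact ENNReal.rpow_le_rpow h (by norm_num)

/-- The norm inequality for `ℳ(gσ)`, `g ≥ 0`. The factor `4 * (α + 3)` comes from the jumps and the
factor `128 * (3 * (2 * R + 3) ^ n)` from the Whitney cells; `3 ^ n` is the number of grids. -/
lemma lintegral_maximal_withDensity_sq_le {n : ℕ} {σ ω : Measure (Fin n → ℝ)}
    [IsLocallyFiniteMeasure σ] {g : (Fin n → ℝ) → ℝ≥0∞} (hg : Measurable g)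
    (hg2 : ∫⁻ x, g x ^ 2 ∂σ ≠ ⊤) {α : ℕ} {Γ : ℝ}
    (hΓ : 1 ≤ Γ) (hα : 2 * Γ ≤ 2 ^ α) {R : ℕ} (hR : Γ ≤ R) {T : ℝ≥0∞}
    (hT : ∀ Q : Cube n,
      ∫⁻ x in Q.toSet, maximal (σ.restrict Q.toSet) x ^ 2 ∂ω ≤ T ^ 2 * σ (Q.dilate Γ)) :
    ∫⁻ x, maximal (σ.withDensity g) x ^ 2 ∂ω ≤
      (64 ^ n * (3 ^ n * (4 * (α + 3) + 128 * (3 * (2 * R + 3) ^ n))) : ℕ) *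
        (T ^ 2 + muckenhouptA2 σ ω) * ∫⁻ x, g x ^ 2 ∂σ := by
  have mJ : ∀ t : Fin n → Fin 3, Measurable (jumpSum t σ g (α + 3)) := fun t =>
    Measurable.tsum fun k => measurable_jump_mul t σ g _ k
  have mD : ∀ t : Fin n → Fin 3, Measurable fun x => ⨆ L : ℕ, deepSum t σ g (α + 3) L x :=
    fun t => Measurable.iSup fun L => measurable_deepSum t σ g _ _
  set I := ∫⁻ x, g x ^ 2 ∂σ
  set N := 3 * (2 * R + 3) ^ n
  set A2 := muckenhouptA2 σ ω
  have mS : ∀ t : Fin n → Fin 3, Measurable fun x =>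
      jumpSum t σ g (α + 3) x + 16 * ⨆ L : ℕ, deepSum t σ g (α + 3) L x :=
    fun t => (mJ t).add ((mD t).const_mul 16)
  have hpt : ∀ x, maximal (σ.withDensity g) x ^ 2 ≤ 64 ^ n * ∑ t : Fin n → Fin 3,
      (jumpSum t σ g (α + 3) x + 16 * ⨆ L : ℕ, deepSum t σ g (α + 3) L x) := by
    intro x
    refine (pow_le_pow_left' (iSup₂_le fun P hP => le_rpow_half_of_sq_le ?_) 2).trans
      (rpow_half_sq _).le
    obtain ⟨t, ht⟩ := cubeAverage_withDensity_sq_le hg2 (α + 3) hP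
    refine ht.trans ?_
    gcongr
    exact Finset.single_le_sum (f := fun t : Fin n → Fin 3 =>
      jumpSum t σ g (α + 3) x + 16 * ⨆ L : ℕ, deepSum t σ g (α + 3) L x)
      (fun _ _ => zero_le) (Finset.mem_univ t)
  calc _ ≤ ∫⁻ x, 64 ^ n * ∑ t : Fin n → Fin 3,
      (jumpSum t σ g (α + 3) x + 16 * ⨆ L : ℕ, deepSum t σ g (α + 3) L x) ∂ω :=
        lintegral_mono hpt
    _ = 64 ^ n * ∑ t : Fin n → Fin 3, (∫⁻ x, jumpSum t σ g (α + 3) x ∂ω +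
        16 * ∫⁻ x, ⨆ L : ℕ, deepSum t σ g (α + 3) L x ∂ω) := by
        rw [lintegral_const_mul _ (Finset.measurable_fun_sum _ fun t _ => mS t),
          lintegral_finsetSum _ fun t _ => mS t]
        congr 2
        funext t
        rw [lintegral_add_left (mJ t), lintegral_const_mul _ (mD t)]
    _ ≤ 64 ^ n * ∑ _t : Fin n → Fin 3, (A2 * ((α + 3 : ℕ) * (4 * I)) +
        16 * ((N : ℕ) * (T ^ 2 * (8 * I)))) := by
        gcongr with t
        · exact lintegral_jumpSum_le t σ ω hg hg2 _
        · exact lintegral_iSup_deepSum_le hg t hΓ hα hR hT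
    _ = 64 ^ n * (3 ^ n * (((4 * (α + 3) : ℕ) : ℝ≥0∞) * A2 * I
        + ((128 * N : ℕ) : ℝ≥0∞) * T ^ 2 * I)) := by
        rw [Finset.sum_const, Finset.card_univ, Fintype.card_pi_const, Fintype.card_fin, nsmul_eq_mul]
        push_cast
        ring
    _ ≤ 64 ^ n * (3 ^ n * (((4 * (α + 3) + 128 * N : ℕ) : ℝ≥0∞) * A2 * I
        + ((4 * (α + 3) + 128 * N : ℕ) : ℝ≥0∞) * T ^ 2 * I)) := by
        gcongr <;> omega
    _ = _ := by
        push_cast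
        ring

lemma maximalMul_congr_ae {n : ℕ} {σ : Measure (Fin n → ℝ)} {f f' : (Fin n → ℝ) → ℝ}
    (h : f =ᵐ[σ] f') : maximalMul f σ = maximalMul f' σ := by
  funext x
  rw [maximalMul, maximalMul, withDensity_congr_ae (g := fun y => ‖f' y‖ₑ)
    (h.mono fun y hy => by simp only [hy])]

/-- Sufficiency of the testing and `A₂` conditions. -/
lemma operatorNorm_le {n : ℕ} {σ ω : Measure (Fin n → ℝ)} [IsLocallyFiniteMeasure σ]
    {α : ℕ} {Γ : ℝ} (hΓ : 1 ≤ Γ) (hα : 2 * Γ ≤ 2 ^ α) {R : ℕ} (hR : Γ ≤ R) :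
    operatorNorm σ ω ≤
      ((64 ^ n * (3 ^ n * (4 * (α + 3) + 128 * (3 * (2 * R + 3) ^ n))) : ℕ) : ℝ≥0∞) *
        (testingConstant Γ σ ω + muckenhouptA2 σ ω ^ (1 / 2 : ℝ)) := by
  set K := 64 ^ n * (3 ^ n * (4 * (α + 3) + 128 * (3 * (2 * R + 3) ^ n)))
  have hK1 : 1 ≤ K := Nat.one_le_iff_ne_zero.2 (by positivity)
  have hK0 : (K : ℝ≥0∞) ≠ 0 := by exact_mod_cast (Nat.one_le_iff_ne_zero.1 hK1)
  -- Isolate the testing constant, to replace it by an arbitrary admissible constant.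
  rw [← ENNReal.div_le_iff' hK0 (ENNReal.natCast_ne_top K), ← tsub_le_iff_right]
  refine le_sInf fun T hT => ?_
  rw [tsub_le_iff_right, ENNReal.div_le_iff' hK0 (ENNReal.natCast_ne_top K)]
  refine sInf_le fun f hf => ?_
  set f' := hf.1.mk f
  have hae : f =ᵐ[σ] f' := hf.1.ae_eq_mk
  have mf' : Measurable f' := hf.1.stronglyMeasurable_mk.measurable
  have hsq : ∫⁻ x, ‖f x‖ₑ ^ 2 ∂σ = ∫⁻ x, ‖f' x‖ₑ ^ 2 ∂σ :=
    lintegral_congr_ae (hae.mono fun y hy => by simp only [hy])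
  have hfin : ∫⁻ x, ‖f' x‖ₑ ^ 2 ∂σ ≠ ⊤ := by
    have := (memLp_congr_ae hae).1 hf
    have h2 := lintegral_rpow_enorm_lt_top_of_eLpNorm_lt_top two_ne_zero (by norm_num) this.2
    simp only [ENNReal.toReal_ofNat, ENNReal.rpow_two] at h2
    exact h2.ne
  rw [maximalMul_congr_ae hae, hsq]
  refine (lintegral_maximal_withDensity_sq_le mf'.enorm hfin hΓ hα hR hT).trans ?_
  gcongr
  rw [mul_pow]
  gcongr
  · exact_mod_cast Nat.le_self_pow two_ne_zero K
  · calc T ^ 2 + muckenhouptA2 σ ω = T ^ 2 + (muckenhouptA2 σ ω ^ (1 / 2 : ℝ)) ^ 2 := by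
          rw [rpow_half_sq]
      _ ≤ T ^ 2 + (muckenhouptA2 σ ω ^ (1 / 2 : ℝ)) ^ 2
          + 2 * T * muckenhouptA2 σ ω ^ (1 / 2 : ℝ) := le_self_add
      _ = _ := by ring

/-- The norm inequality for the indicator function of a cube. -/
lemma lintegral_maximal_restrict_sq_le {n : ℕ} {σ ω : Measure (Fin n → ℝ)}
    [IsLocallyFiniteMeasure σ] {C : ℝ≥0∞} (hC : ∀ f : (Fin n → ℝ) → ℝ, MemLp f 2 σ →
      ∫⁻ x, maximalMul f σ x ^ 2 ∂ω ≤ C ^ 2 * ∫⁻ x, ‖f x‖ₑ ^ 2 ∂σ) (Q : Cube n) :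
    ∫⁻ x, maximal (σ.restrict Q.toSet) x ^ 2 ∂ω ≤ C ^ 2 * σ Q.toSet := by
  have hQ := Q.measurableSet_toSet
  have e : (fun y => ‖Q.toSet.indicator (fun _ => (1 : ℝ)) y‖ₑ) = Q.toSet.indicator 1 := by
    funext y
    by_cases hy : y ∈ Q.toSet <;> simp [hy]
  have e2 : ∫⁻ x, ‖Q.toSet.indicator (fun _ => (1 : ℝ)) x‖ₑ ^ 2 ∂σ = σ Q.toSet := by
    rw [← lintegral_indicator_one hQ]
    refine lintegral_congr fun x => ?_
    by_cases hx : x ∈ Q.toSet <;> simp [hx]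
  have h := hC (Q.toSet.indicator fun _ => 1)
    (memLp_indicator_const 2 hQ 1 (Or.inr (Q.measure_toSet_ne_top σ)))
  rw [e2] at h
  simpa only [maximalMul, e, withDensity_indicator_one hQ] using h

/-- Necessity of the testing condition. -/
lemma testingConstant_le_operatorNorm {n : ℕ} (σ ω : Measure (Fin n → ℝ))
    [IsLocallyFiniteMeasure σ] {Γ : ℝ} (hΓ : 1 ≤ Γ) :
    testingConstant Γ σ ω ≤ operatorNorm σ ω := by
  refine le_sInf fun C hC => sInf_le fun Q => ?_
  refine ((setLIntegral_le_lintegral _ _).trans (lintegral_maximal_restrict_sq_le hC Q)).trans ?_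
  gcongr
  exact Q.toSet_subset_dilate hΓ

/-- Necessity of the `A₂` condition: on a cube, the maximal function of the restriction of `σ` to it
is at least the average. -/
lemma muckenhouptA2_rpow_le_operatorNorm {n : ℕ} (σ ω : Measure (Fin n → ℝ))
    [IsLocallyFiniteMeasure σ] :
    muckenhouptA2 σ ω ^ (1 / 2 : ℝ) ≤ operatorNorm σ ω := by
  refine le_sInf fun C hC => ?_
  rw [← sq_rpow_half C]
  refine ENNReal.rpow_le_rpow (iSup_le fun Q => ?_) (by norm_num)
  -- The case `σ Q = 0` is separate because the inequality is divided by `σ Q` below.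
  rcases eq_or_ne (σ Q.toSet) 0 with h0 | h0
  · simp [cubeAverage, h0]
  have ht := Q.measure_toSet_ne_top σ
  have h1 : cubeAverage σ Q ^ 2 * ω Q.toSet ≤ C ^ 2 * σ Q.toSet := by
    refine le_trans ?_ (lintegral_maximal_restrict_sq_le hC Q)
    rw [← setLIntegral_const]
    refine (setLIntegral_mono' Q.measurableSet_toSet fun x hx => ?_).trans
      (setLIntegral_le_lintegral Q.toSet _)
    gcongr
    refine le_trans (le_of_eq ?_) (cubeAverage_le_maximal _ hx)
    rw [cubeAverage, cubeAverage, Measure.restrict_apply_self]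
  calc cubeAverage σ Q * cubeAverage ω Q
      = cubeAverage σ Q * cubeAverage ω Q * (σ Q.toSet * (σ Q.toSet)⁻¹) := by
        rw [ENNReal.mul_inv_cancel h0 ht, mul_one]
    _ = cubeAverage σ Q ^ 2 * ω Q.toSet * (σ Q.toSet)⁻¹ := by
        simp only [cubeAverage, div_eq_mul_inv]; ring
    _ ≤ C ^ 2 * σ Q.toSet * (σ Q.toSet)⁻¹ := by gcongr
    _ = C ^ 2 := by rw [mul_assoc, ENNReal.mul_inv_cancel h0 ht, mul_one]

end RestrictedTesting

end

/-- For `Γ > 1`, the operator norm of the maximal function from `L²(σ)` to `L²(ω)` is comparable to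
the `Γ`-testing constant plus the square root of the `A₂` characteristic, for all pairs of locally
finite positive Borel measures, with constants that depend only on `Γ` and `n`. -/
theorem theorem2 (n : ℕ) (Γ : ℝ) (hΓ : 1 < Γ) :
    ∃ c C : ℝ≥0, 0 < c ∧ 0 < C ∧
      ∀ (σ ω : Measure (Fin n → ℝ)) [IsLocallyFiniteMeasure σ] [IsLocallyFiniteMeasure ω],
        (c : ℝ≥0∞) * (RestrictedTesting.testingConstant Γ σ ω
            + RestrictedTesting.muckenhouptA2 σ ω ^ (1 / 2 : ℝ))
          ≤ RestrictedTesting.operatorNorm σ ω ∧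
        RestrictedTesting.operatorNorm σ ω
          ≤ (C : ℝ≥0∞) * (RestrictedTesting.testingConstant Γ σ ω
            + RestrictedTesting.muckenhouptA2 σ ω ^ (1 / 2 : ℝ)) := by
  obtain ⟨α, hα⟩ := pow_unbounded_of_one_lt (2 * Γ) (one_lt_two)
  obtain ⟨R, hR⟩ := exists_nat_ge Γ
  refine ⟨1 / 2, ((64 ^ n * (3 ^ n * (4 * (α + 3) + 128 * (3 * (2 * R + 3) ^ n))) : ℕ) : ℝ≥0),
    by norm_num, by positivity, fun σ ω _ _ => ⟨?_, ?_⟩⟩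
  · calc _ ≤ ((1 / 2 : ℝ≥0) : ℝ≥0∞) * (RestrictedTesting.operatorNorm σ ω
          + RestrictedTesting.operatorNorm σ ω) := by
          gcongr
          · exact RestrictedTesting.testingConstant_le_operatorNorm σ ω hΓ.le
          · exact RestrictedTesting.muckenhouptA2_rpow_le_operatorNorm σ ω
      _ = _ := by
          rw [← two_mul, ← mul_assoc]
          have : ((1 / 2 : ℝ≥0) : ℝ≥0∞) * 2 = 1 := by
            rw [show (2 : ℝ≥0∞) = ((2 : ℝ≥0) : ℝ≥0∞) by norm_num, ← ENNReal.coe_mul]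
            norm_num
          rw [this, one_mul]
  · exact RestrictedTesting.operatorNorm_le hΓ.le hα.le hR
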